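/- Let $H^3$ be three-dimensional hyperbolic space with its canonical orientation. Let $S$ be a compact (connected, smoothly embedded) surface in $H^3$ that is quadratically convex: $S$ is strictly convex, i.e. for every $p\in S$ the complete totally geodesic surface tangent to $S$ at $p$ meets $S$ only at $p$, and the shape operator of $S$ is definite at every point. Let $\mathcal U$ be the set of oriented lines (oriented, unparametrized complete geodesics) of $H^3$ that do not meet $S$. For $\ell=[\gamma]\in\mathcal U$ there are exactly two complete totally geodesic surfaces $P_+,P_-$ that contain $\ell$ and are tangent to $S$, at points $p_+,p_-$ say. Let $q_\pm$ be the point of $\ell$ nearest to $p_\pm$, let $\gamma_\pm$ be the unit speed geodesic ray from $q_\pm$ through $p_\pm$, and let $W_\pm$ be the parallel vector field along $\gamma$ whose value at $q_\pm$ is $\gamma_\pm'(0)$; the labels are chosen so that $\{W_+,W_-,\gamma'\}$ is positively oriented. The outer billiard map $B:\mathcal U\to\mathcal U$ associated with $S$ sends $\ell$ to the oriented line obtained by parallel transporting $\ell$ along $\gamma_+$ from $\gamma_+(0)=q_+$ to $\gamma_+(2d)$, where $d$ is the distance from $q_+$ to $p_+$. If $\ell\in\mathcal U$ is a periodic point of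 $B$ of minimal period $n$, put $\ell_k=B^k(\ell)$ and let $d_k\in\mathbb R$ be the signed distance from $q_-(\ell_k)$ to $q_+(\ell_k)$, that is, $\gamma_k(d_k)=q_+(\ell_k)$ where $\ell_k=[\gamma_k]$, $\gamma_k$ has unit speed and $\gamma_k(0)=q_-(\ell_k)$. The holonomy of $B$ at $\ell$ is $\sum_{k=0}^{n-1}d_k$. There exist a quadratically convex compact surface $S$ in $H^3$ and an oriented line $\ell$ not meeting $S$ which is a periodic point of minimal period $4$ of the outer billiard map associated with $S$ and whose holonomy is not zero. -/

import Mathlib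

open scoped ContDiff

noncomputable section

namespace OuterBilliard

/-- The underlying vector space of Minkowski space of signature `(3, 1)`. -/
abbrev Mink : Type := Fin 4 → ℝ

/-- The Lorentz form `-x₀y₀ + x₁y₁ + x₂y₂ + x₃y₃`. -/
def lor (x y : Mink) : ℝ := -(x 0 * y 0) + x 1 * y 1 + x 2 * y 2 + x 3 * y 3

/-- Hyperbolic three-space (hyperboloid model). The tangent space at `x` is
`{v | lor x v = 0}` and the Riemannian metric is the restriction of `lor` to it. -/
def H3 : Set Mink := {x | lor x x = -1 ∧ 0 < x 0}

/-- The hyperbolic distance. -/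
def hdist (x y : Mink) : ℝ := Real.arcosh (-lor x y)

/-- The `lor`-orthogonal projection of an ambient vector onto the tangent space of `H3` at `x`. -/
def tanProj (x v : Mink) : Mink := v + lor x v • x

/-- The Levi-Civita covariant derivative of a vector field `X` along a curve `c` in `H3`:
the tangential part of the ordinary derivative. -/
def covDeriv (c X : ℝ → Mink) (t : ℝ) : Mink := tanProj (c t) (deriv X t)

/-- `X` is a smooth parallel tangent vector field along the curve `c` in `H3`. -/
def IsParallel (c X : ℝ → Mink) : Prop :=
  ContDiff ℝ ∞ X ∧ (∀ t, lor (c t) (X t) = 0) ∧ ∀ t, covDeriv c X t = 0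

/-- A frame `(u, v, w)` of the tangent space at `x ∈ H3` is positive for the canonical
orientation, in which the coordinate frame is positive at `(1, 0, 0, 0)`. -/
def PosFrame (x u v w : Mink) : Prop := 0 < (Matrix.of ![x, u, v, w]).det

/-- Complete unit speed geodesics of `H3`. -/
structure Geod where
  toFun : ℝ → Mink
  mem : ∀ t, toFun t ∈ H3
  smooth : ContDiff ℝ ∞ toFun
  unit_speed : ∀ t, lor (deriv toFun t) (deriv toFun t) = 1
  geodesic : ∀ t, covDeriv toFun (deriv toFun) t = 0

instance : CoeFun Geod (fun _ => ℝ → Mink) := ⟨Geod.toFun⟩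

/-- Two unit speed geodesics are equivalent if they differ by a shift of the parameter. -/
instance geodSetoid : Setoid Geod where
  r γ σ := ∃ t₀ : ℝ, ∀ t, σ t = γ (t + t₀)
  iseqv :=
    { refl := fun γ => ⟨0, fun t => by simp⟩
      symm := by
        rintro γ σ ⟨a, h⟩
        exact ⟨-a, fun t => by rw [h]; simp⟩
      trans := by
        rintro γ σ τ ⟨a, h⟩ ⟨b, k⟩
        exact ⟨b + a, fun t => by rw [k, h, add_assoc]⟩ }

/-- Oriented (unparametrized, complete) geodesics of `H3`. -/
abbrev OrLine : Type := Quotient geodSetoid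

/-- `γ` is a unit speed parametrization of the oriented line `ℓ`. -/
def Geod.Represents (γ : Geod) (ℓ : OrLine) : Prop := (Quotient.mk geodSetoid γ) = ℓ

/-- The set of points of an oriented line. -/
def OrLine.points (ℓ : OrLine) : Set Mink := {x | ∃ γ : Geod, γ.Represents ℓ ∧ ∃ t, γ t = x}

/-- A connected compact smooth embedded surface in `H3`, together with a smooth unit normal
field (which is unique up to sign; no choice between inward and outward is made).
The field `normal` matters only on `carrier`; it is extended smoothly to a neighbourhood. -/
structure CompactSurface where
  carrier : Set Mink
  normal : Mink → Mink
  subset_H3 : carrier ⊆ H3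
  isCompact : IsCompact carrier
  isConnected : IsConnected carrier
  /-- Near each of its points the surface is a regular level set in `H3`, and `normal` is
  orthogonal to it. -/
  regular : ∀ p ∈ carrier, ∃ U : Set Mink, IsOpen U ∧ p ∈ U ∧ ∃ f : Mink → ℝ,
    ContDiffOn ℝ ∞ f U ∧ carrier ∩ U = {x | x ∈ H3 ∧ x ∈ U ∧ f x = 0} ∧
    ∃ c : ℝ, c ≠ 0 ∧ ∀ v, lor p v = 0 → fderiv ℝ f p v = c * lor (normal p) v
  normal_smooth : ∃ U : Set Mink, IsOpen U ∧ carrier ⊆ U ∧ ContDiffOn ℝ ∞ normal U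
  normal_tangent : ∀ p ∈ carrier, lor p (normal p) = 0
  normal_unit : ∀ p ∈ carrier, lor (normal p) (normal p) = 1

namespace CompactSurface

variable (S : CompactSurface)

/-- The tangent space of the surface at one of its points. -/
def tangentSpace (p : Mink) : Set Mink := {v | lor p v = 0 ∧ lor (S.normal p) v = 0}

/-- The shape operator `x ↦ -∇ₓ n`. -/
def shape (p x : Mink) : Mink := -tanProj p (fderiv ℝ S.normal p x)

/-- The complete totally geodesic surface tangent to `S` at `p`: the section of the hyperboloid
by the linear hyperplane spanned by `p` and the tangent space of `S` at `p`. -/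
def tangentPlane (p : Mink) : Set Mink := {x | x ∈ H3 ∧ lor (S.normal p) x = 0}

/-- Each tangent plane meets the surface only at the point of tangency. -/
def StrictlyConvex : Prop := ∀ p ∈ S.carrier, S.tangentPlane p ∩ S.carrier = {p}

/-- A strictly convex surface whose shape operator is definite at every point. -/
def QuadraticallyConvex : Prop :=
  S.StrictlyConvex ∧ ∀ p ∈ S.carrier,
    (∀ x ∈ S.tangentSpace p, x ≠ 0 → 0 < lor (S.shape p x) x) ∨
    (∀ x ∈ S.tangentSpace p, x ≠ 0 → lor (S.shape p x) x < 0)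

/-- The billiard table: the oriented lines that do not meet the surface. -/
def Table : Type := {ℓ : OrLine // Disjoint ℓ.points S.carrier}

/-- The points of `S` at which the tangent plane contains the line `ℓ`. -/
def touchPoints (ℓ : OrLine) : Set Mink := {p | p ∈ S.carrier ∧ ℓ.points ⊆ S.tangentPlane p}

end CompactSurface

/-- `q` is a point of `ℓ` realizing the distance from `p` to `ℓ`. -/
def IsFoot (ℓ : OrLine) (p q : Mink) : Prop :=
  q ∈ ℓ.points ∧ ∀ x ∈ ℓ.points, hdist q p ≤ hdist x p

/-- `σ` is a unit speed geodesic that runs from `q` (time `0`) to `p` (time `hdist q p`). -/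
def Joins (σ : Geod) (q p : Mink) : Prop := σ 0 = q ∧ σ (hdist q p) = p

/-- The frame `{W₊, W₋, γ'}` along `ℓ = [γ]` is positively oriented, where `W₊`, `W₋` are the
parallel fields along `γ` that at `q₊`, `q₋` are the initial velocities of the unit speed
geodesics from `q₊` to `p₊` and from `q₋` to `p₋`. -/
def RightLeft (ℓ : OrLine) (pPlus pMinus qPlus qMinus : Mink) : Prop :=
  ∃ (γ σPlus σMinus : Geod) (tPlus tMinus : ℝ) (WPlus WMinus : ℝ → Mink),
    γ.Represents ℓ ∧ γ tPlus = qPlus ∧ γ tMinus = qMinus ∧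
    Joins σPlus qPlus pPlus ∧ Joins σMinus qMinus pMinus ∧
    IsParallel γ WPlus ∧ WPlus tPlus = deriv σPlus 0 ∧
    IsParallel γ WMinus ∧ WMinus tMinus = deriv σMinus 0 ∧
    ∀ t, PosFrame (γ t) (WPlus t) (WMinus t) (deriv γ t)

/-- `p₊, p₋` are the points of tangency of the (exactly two) tangent planes of `S` that contain
`ℓ`, labelled by the orientation of `ℓ`, and `q₊, q₋` are the points of `ℓ` nearest to them. -/
structure IsConfig (S : CompactSurface) (ℓ : OrLine) (pPlus pMinus qPlus qMinus : Mink) :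
    Prop where
  touch : S.touchPoints ℓ = {pPlus, pMinus}
  foot_plus : IsFoot ℓ pPlus qPlus
  foot_minus : IsFoot ℓ pMinus qMinus
  right_left : RightLeft ℓ pPlus pMinus qPlus qMinus

/-- `ℓ'` is obtained by parallel transporting `ℓ` along the geodesic `σ`, which starts on `ℓ`,
between times `0` and `s`. -/
def IsParallelTranslate (ℓ : OrLine) (σ : Geod) (s : ℝ) (ℓ' : OrLine) : Prop :=
  ∃ (γ γ' : Geod) (X : ℝ → Mink), γ.Represents ℓ ∧ γ'.Represents ℓ' ∧ IsParallel σ X ∧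
    γ 0 = σ 0 ∧ deriv γ 0 = X 0 ∧ γ' 0 = σ s ∧ deriv γ' 0 = X s

/-- The graph of the outer billiard map: `ℓ'` is the parallel transport of `ℓ` along the geodesic
ray from `q₊` through `p₊`, between `0` and twice the distance from `q₊` to `p₊`. -/
def IsImage (S : CompactSurface) (ℓ ℓ' : OrLine) : Prop :=
  ∃ (pPlus pMinus qPlus qMinus : Mink) (σ : Geod), IsConfig S ℓ pPlus pMinus qPlus qMinus ∧
    Joins σ qPlus pPlus ∧ IsParallelTranslate ℓ σ (2 * hdist qPlus pPlus) ℓ'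

open Classical in
/-- The outer billiard map `B` of the table of `S`. For a strictly convex compact surface the
line `ℓ'` always exists and is unique; otherwise the map is given the dummy value `ℓ`
(so that a point where the dummy value is used is a fixed point). -/
def outerBilliard (S : CompactSurface) (ℓ : S.Table) : S.Table :=
  if h : ∃! ℓ' : S.Table, IsImage S ℓ.1 ℓ'.1 then h.choose else ℓ

/-- `d` is the signed distance from `q₋` to `q₊` along `ℓ`: if `ℓ = [γ]` with `γ 0 = q₋`, then
`γ d = q₊`. -/
def IsSignedDist (S : CompactSurface) (ℓ : OrLine) (d : ℝ) : Prop :=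
  ∃ (pPlus pMinus qPlus qMinus : Mink) (γ : Geod), IsConfig S ℓ pPlus pMinus qPlus qMinus ∧
    γ.Represents ℓ ∧ γ 0 = qMinus ∧ γ d = qPlus

/-- `h` is the holonomy of the outer billiard map at its periodic point `ℓ`: the sum of the
signed distances from `q₋` to `q₊` over one period of the orbit. -/
def IsHolonomy (S : CompactSurface) (ℓ : S.Table) (h : ℝ) : Prop :=
  ℓ ∈ Function.periodicPts (outerBilliard S) ∧
  ∃ d : ℕ → ℝ,
    (∀ k < Function.minimalPeriod (outerBilliard S) ℓ,
      IsSignedDist S ((outerBilliard S)^[k] ℓ).1 (d k)) ∧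
    h = ∑ k ∈ Finset.range (Function.minimalPeriod (outerBilliard S) ℓ), d k

end OuterBilliard

end

open scoped ContDiff

noncomputable section

namespace OuterBilliard

/-! ### Lorentz algebra -/

/-! The example is explicit. In the hyperboloid model a line is the curve cosh t q + sinh t e, and a
vector orthogonal to both q and e is parallel along it. Transporting a line along the perpendicular
from its foot through the point of tangency a, for twice the distance, therefore leaves the ambient
velocity vector unchanged and moves the foot x to its point reflection -x - 2⟨x, a⟩a. One
application of the billiard map thus becomes linear algebra: `Step` records the data of a line with
its two tangency points, and `Step.outerBilliard_eq` says when one step leads to the next.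

The surface is cut out of the hyperboloid by a homogeneous quartic: fourth powers of four linear
forms, plus x₀² times a positive form in the space coordinates, minus a multiple of x₀⁴. In the
chart x₀ = 1 this is a strictly convex function, and tangent planes are linear sections, so strict
convexity in the chart gives it in hyperbolic space; the Hessian gives definiteness of the shape
operator (`ConvexEquation.quadraticallyConvex`, `quartic_gradient_inequality`, `quarticHess_pos`).
The bound `quartic_bound` keeps the surface inside the ball of the Klein model.

The quartic is invariant under the half-turns about the three coordinate axes. The four tangency
points form one orbit of this Klein four-group, and their tangent planes, taken in cyclic order,
meet successively in the four lines of the periodic orbit. Each line is reversed by a half-turn that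
exchanges its two tangency points; the half-turn about the third axis exchanges the two even lines
and the two odd lines. Hence the signed distances alternate between two values, which no symmetry
relates: arsinh(33/56) on odd lines and -arsinh(495/952) on even ones. Their sum is not zero. -/

theorem lor_comm (x y : Mink) : lor x y = lor y x := by simp only [lor]; ring

theorem lor_add_left (x y z : Mink) : lor (x + y) z = lor x z + lor y z := by
  simp only [lor, Pi.add_apply]; ring

theorem lor_smul_left (a : ℝ) (x z : Mink) : lor (a • x) z = a * lor x z := by
  simp only [lor, Pi.smul_apply, smul_eq_mul]; ring

theorem lor_add_right (x y z : Mink) : lor x (y + z) = lor x y + lor x z := by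
  simp only [lor, Pi.add_apply]; ring

theorem lor_smul_right (a : ℝ) (x z : Mink) : lor x (a • z) = a * lor x z := by
  simp only [lor, Pi.smul_apply, smul_eq_mul]; ring

theorem lor_neg_left (x z : Mink) : lor (-x) z = -lor x z := by
  simp only [lor, Pi.neg_apply]; ring

theorem lor_sub_left (x y z : Mink) : lor (x - y) z = lor x z - lor y z := by
  simp only [lor, Pi.sub_apply]; ring

theorem lor_sub_right (x y z : Mink) : lor x (y - z) = lor x y - lor x z := by
  simp only [lor, Pi.sub_apply]; ring

theorem lor_zero_right (x : Mink) : lor x 0 = 0 := by simp [lor]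

theorem lor_zero_left (x : Mink) : lor 0 x = 0 := by simp [lor]

theorem HasDerivAt.lor {f g : ℝ → Mink} {f' g' : Mink} {t : ℝ} (hf : HasDerivAt f f' t)
    (hg : HasDerivAt g g' t) :
    HasDerivAt (fun s => lor (f s) (g s)) (lor f' (g t) + lor (f t) g') t := by
  rw [hasDerivAt_pi] at hf hg
  have h := ((((hf 0).mul (hg 0)).neg.add ((hf 1).mul (hg 1))).add ((hf 2).mul (hg 2))).add
    ((hf 3).mul (hg 3))
  refine h.congr_deriv ?_
  simp only [OuterBilliard.lor]; ring

/-- Cauchy–Schwarz for the space parts, with Lagrange's identity supplying the defect: the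
complement of a timelike vector is positive definite. -/
theorem lor_self_pos {p v : Mink} (hp : lor p p = -1) (h : lor p v = 0) (hv : v ≠ 0) :
    0 < lor v v := by
  simp only [lor] at *
  have h0 : p 0 * v 0 = p 1 * v 1 + p 2 * v 2 + p 3 * v 3 := by linarith
  have key : 0 ≤ (p 1 * v 2 - p 2 * v 1) ^ 2 + (p 1 * v 3 - p 3 * v 1) ^ 2
      + (p 2 * v 3 - p 3 * v 2) ^ 2 := by positivity
  have e : (p 1 ^ 2 + p 2 ^ 2 + p 3 ^ 2) * (v 1 ^ 2 + v 2 ^ 2 + v 3 ^ 2) =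
      (p 0 * v 0) ^ 2 + ((p 1 * v 2 - p 2 * v 1) ^ 2 + (p 1 * v 3 - p 3 * v 1) ^ 2
      + (p 2 * v 3 - p 3 * v 2) ^ 2) := by rw [h0]; ring
  have e2 : p 0 ^ 2 = 1 + (p 1 ^ 2 + p 2 ^ 2 + p 3 ^ 2) := by linarith
  have hs : 0 < v 1 ^ 2 + v 2 ^ 2 + v 3 ^ 2 := by
    by_contra hcon
    have h1 : v 1 = 0 := by nlinarith [sq_nonneg (v 1), sq_nonneg (v 2), sq_nonneg (v 3)]
    have h2 : v 2 = 0 := by nlinarith [sq_nonneg (v 1), sq_nonneg (v 2), sq_nonneg (v 3)]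
    have h3 : v 3 = 0 := by nlinarith [sq_nonneg (v 1), sq_nonneg (v 2), sq_nonneg (v 3)]
    rw [h1, h2, h3] at h0
    have h4 : v 0 = 0 := by
      have : p 0 ≠ 0 := by nlinarith [sq_nonneg (p 1), sq_nonneg (p 2), sq_nonneg (p 3)]
      simpa [this] using h0
    exact hv (by ext i; fin_cases i <;> assumption)
  have h5 : p 0 ^ 2 * (v 1 ^ 2 + v 2 ^ 2 + v 3 ^ 2 - v 0 ^ 2) =
      (v 1 ^ 2 + v 2 ^ 2 + v 3 ^ 2) + ((p 1 * v 2 - p 2 * v 1) ^ 2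
      + (p 1 * v 3 - p 3 * v 1) ^ 2 + (p 2 * v 3 - p 3 * v 2) ^ 2) := by
    rw [mul_sub, ← mul_pow, eq_sub_of_add_eq e.symm, e2]; ring
  have h6 : 0 < p 0 ^ 2 * (v 1 ^ 2 + v 2 ^ 2 + v 3 ^ 2 - v 0 ^ 2) := by rw [h5]; positivity
  have := pos_of_mul_pos_right h6 (sq_nonneg _)
  linarith

/-- The time coordinate of a vector orthogonal to a future unit timelike vector. -/
theorem abs_time_lt {q w : Mink} (hq : q ∈ H3) (h : lor q w = 0) (hw : lor w w = 1) :
    |w 0| < q 0 := by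
  obtain ⟨hq1, hq0⟩ := hq
  rw [← abs_of_pos hq0, ← sq_lt_sq]
  simp only [lor] at *
  have h0 : q 0 * w 0 = q 1 * w 1 + q 2 * w 2 + q 3 * w 3 := by linarith
  have key : 0 ≤ (q 1 * w 2 - q 2 * w 1) ^ 2 + (q 1 * w 3 - q 3 * w 1) ^ 2
      + (q 2 * w 3 - q 3 * w 2) ^ 2 := by positivity
  have e : (q 1 ^ 2 + q 2 ^ 2 + q 3 ^ 2) * (w 1 ^ 2 + w 2 ^ 2 + w 3 ^ 2) =
      (q 0 * w 0) ^ 2 + ((q 1 * w 2 - q 2 * w 1) ^ 2 + (q 1 * w 3 - q 3 * w 1) ^ 2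
      + (q 2 * w 3 - q 3 * w 2) ^ 2) := by rw [h0]; ring
  have e2 : q 1 ^ 2 + q 2 ^ 2 + q 3 ^ 2 = q 0 ^ 2 - 1 := by linarith
  have e3 : w 1 ^ 2 + w 2 ^ 2 + w 3 ^ 2 = w 0 ^ 2 + 1 := by linarith
  rw [e2, e3] at e
  nlinarith

theorem lor_neg {p q : Mink} (hp : p ∈ H3) (hq : q ∈ H3) : lor p q < 0 := by
  obtain ⟨hp1, hp0⟩ := hp
  obtain ⟨hq1, hq0⟩ := hq
  simp only [lor] at *
  have hpq : 0 < p 0 * q 0 := mul_pos hp0 hq0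
  have key : 0 ≤ (p 1 * q 2 - p 2 * q 1) ^ 2 + (p 1 * q 3 - p 3 * q 1) ^ 2
      + (p 2 * q 3 - p 3 * q 2) ^ 2 := by positivity
  have e : (p 1 ^ 2 + p 2 ^ 2 + p 3 ^ 2) * (q 1 ^ 2 + q 2 ^ 2 + q 3 ^ 2) =
      (p 1 * q 1 + p 2 * q 2 + p 3 * q 3) ^ 2 + ((p 1 * q 2 - p 2 * q 1) ^ 2
      + (p 1 * q 3 - p 3 * q 1) ^ 2 + (p 2 * q 3 - p 3 * q 2) ^ 2) := by ring
  have e2 : p 1 ^ 2 + p 2 ^ 2 + p 3 ^ 2 = p 0 ^ 2 - 1 := by linarith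
  have e3 : q 1 ^ 2 + q 2 ^ 2 + q 3 ^ 2 = q 0 ^ 2 - 1 := by linarith
  have hp2 : 0 ≤ p 1 ^ 2 + p 2 ^ 2 + p 3 ^ 2 := by positivity
  rw [e2, e3] at e
  have h : (p 1 * q 1 + p 2 * q 2 + p 3 * q 3) ^ 2 < (p 0 * q 0) ^ 2 := by nlinarith
  have := (abs_lt_of_sq_lt_sq' h hpq.le).2
  linarith

/-- Reverse Cauchy–Schwarz: the component of q tangent at p is spacelike, and its square is ⟨p, q⟩²
- 1. -/
theorem one_lt_neg_lor {p q : Mink} (hp : p ∈ H3) (hq : q ∈ H3) (h : p ≠ q) :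
    1 < -lor p q := by
  have hn := lor_neg hp hq
  have hv : q + lor p q • p ≠ 0 := by
    intro h0
    have e : q = (-lor p q) • p := by rw [neg_smul]; exact eq_neg_of_add_eq_zero_left h0
    have h1 : (lor p q) ^ 2 = 1 := by
      have := hq.1
      rw [e, lor_smul_left, lor_smul_right, hp.1] at this
      linarith
    have h2 : lor p q = -1 := by nlinarith
    rw [h2] at e
    exact h (by simpa using e.symm)
  have := lor_self_pos hp.1 (v := q + lor p q • p)
    (by rw [lor_add_right, lor_smul_right, hp.1]; ring) hv
  simp only [lor_add_left, lor_add_right, lor_smul_left, lor_smul_right, hp.1, hq.1,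
    lor_comm q p] at this
  nlinarith

/-! ### Geodesics -/

/-- The curve `t ↦ cosh t q + sinh t w`. -/
def hyp (q w : Mink) (t : ℝ) : Mink := Real.cosh t • q + Real.sinh t • w

/-- The velocity of `hyp q w`. -/
def hypVel (q w : Mink) (t : ℝ) : Mink := Real.sinh t • q + Real.cosh t • w

theorem hyp_zero (q w : Mink) : hyp q w 0 = q := by simp [hyp]

theorem hypVel_zero (q w : Mink) : hypVel q w 0 = w := by simp [hypVel]

theorem hasDerivAt_hyp (q w : Mink) (t : ℝ) : HasDerivAt (hyp q w) (hypVel q w t) t :=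
  ((Real.hasDerivAt_cosh t).smul_const q).add ((Real.hasDerivAt_sinh t).smul_const w)

theorem hasDerivAt_hypVel (q w : Mink) (t : ℝ) : HasDerivAt (hypVel q w) (hyp q w t) t :=
  ((Real.hasDerivAt_sinh t).smul_const q).add ((Real.hasDerivAt_cosh t).smul_const w)

theorem deriv_hyp (q w : Mink) : deriv (hyp q w) = hypVel q w :=
  funext fun t => (hasDerivAt_hyp q w t).deriv

theorem hyp_add (q w : Mink) (s t : ℝ) :
    hyp q w (s + t) = hyp (hyp q w s) (hypVel q w s) t := by
  simp only [hyp, hypVel, Real.cosh_add, Real.sinh_add]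
  module

theorem hypVel_add (q w : Mink) (s t : ℝ) :
    hypVel q w (s + t) = hypVel (hyp q w s) (hypVel q w s) t := by
  simp only [hyp, hypVel, Real.cosh_add, Real.sinh_add]
  module

/-- A point of `H3` with a unit tangent vector at it. -/
structure UnitTangent (q w : Mink) : Prop where
  mem : q ∈ H3
  orth : lor q w = 0
  unit : lor w w = 1

namespace UnitTangent

variable {q w : Mink}

theorem at_time (h : UnitTangent q w) (t : ℝ) : UnitTangent (hyp q w t) (hypVel q w t) := by
  have hc := Real.cosh_sq t
  refine ⟨⟨?_, ?_⟩, ?_, ?_⟩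
  · simp only [hyp, lor_add_left, lor_add_right, lor_smul_left, lor_smul_right, h.mem.1, h.orth,
      h.unit, lor_comm w q]
    linear_combination -hc
  · have h1 := abs_time_lt h.mem h.orth h.unit
    have h2 : |Real.sinh t| < Real.cosh t := by
      rw [← abs_of_pos (Real.cosh_pos t), ← sq_lt_sq, hc]; linarith
    have h3 : |Real.sinh t * w 0| < Real.cosh t * q 0 := by
      rw [abs_mul]
      exact mul_lt_mul'' h2 h1 (abs_nonneg _) (abs_nonneg _)
    have := (abs_lt.1 h3).1
    simp only [hyp, Pi.add_apply, Pi.smul_apply, smul_eq_mul]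
    linarith
  · simp only [hyp, hypVel, lor_add_left, lor_add_right, lor_smul_left, lor_smul_right, h.mem.1,
      h.orth, h.unit, lor_comm w q]
    ring
  · simp only [hypVel, lor_add_left, lor_add_right, lor_smul_left, lor_smul_right, h.mem.1,
      h.orth, h.unit, lor_comm w q]
    linear_combination hc

/-- The geodesic with given initial data. -/
def geod (h : UnitTangent q w) : Geod where
  toFun := hyp q w
  mem t := (h.at_time t).mem
  smooth := (Real.contDiff_cosh.smul contDiff_const).add (Real.contDiff_sinh.smul contDiff_const)
  unit_speed t := by rw [deriv_hyp]; exact (h.at_time t).unit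
  geodesic t := by
    rw [deriv_hyp, covDeriv, tanProj, (hasDerivAt_hypVel q w t).deriv, (h.at_time t).mem.1]
    simp

theorem geod_apply (h : UnitTangent q w) (t : ℝ) : h.geod t = hyp q w t := rfl

theorem deriv_geod (h : UnitTangent q w) (t : ℝ) : deriv h.geod t = hypVel q w t := by
  change deriv (hyp q w) t = _
  rw [deriv_hyp]

end UnitTangent

namespace Geod

variable (γ : Geod)

theorem hasDerivAt (t : ℝ) : HasDerivAt γ (deriv γ t) t :=
  ((γ.smooth.differentiable (by simp)) t).hasDerivAt

theorem unitTangent (t : ℝ) : UnitTangent (γ t) (deriv γ t) := by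
  refine ⟨γ.mem t, ?_, γ.unit_speed t⟩
  have h := (HasDerivAt.lor (γ.hasDerivAt t) (γ.hasDerivAt t)).unique
    ((hasDerivAt_const t (-1 : ℝ)).congr_of_eventuallyEq
      (Filter.Eventually.of_forall fun s => (γ.mem s).1))
  rw [lor_comm (deriv γ.toFun t)] at h
  linarith

/-- The geodesic equation is γ'' = γ: differentiating ⟨γ, γ'⟩ = 0 gives ⟨γ, γ''⟩ = -1, so the
tangential part of γ'' is γ'' - γ. -/
theorem hasDerivAt_deriv (t : ℝ) : HasDerivAt (deriv γ) (γ t) t := by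
  have h1 : HasDerivAt (deriv γ) (deriv (deriv γ) t) t := by
    exact ((contDiff_infty_iff_deriv.1 γ.smooth).2.differentiable (by simp) t).hasDerivAt
  have h2 := (HasDerivAt.lor (γ.hasDerivAt t) h1).unique
    ((hasDerivAt_const t (0 : ℝ)).congr_of_eventuallyEq
      (Filter.Eventually.of_forall fun s => (γ.unitTangent s).orth))
  have h3 := γ.geodesic t
  rw [γ.unit_speed t] at h2
  rw [covDeriv, tanProj, show lor (γ.toFun t) (deriv (deriv γ.toFun) t) = -1 by linarith] at h3
  have h4 : deriv (deriv γ) t = γ t := by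
    have := eq_neg_of_add_eq_zero_left h3
    simpa using this
  rwa [h4] at h1

theorem eq_hyp (t : ℝ) : γ t = hyp (γ 0) (deriv γ 0) t := by
  -- These two combinations invert the hyperbolic rotation by s, so they are constants of the motion
  -- for γ'' = γ.
  have h1 : ∀ s, HasDerivAt (fun s => Real.cosh s • γ s - Real.sinh s • deriv γ s) 0 s := by
    intro s
    refine (((Real.hasDerivAt_cosh s).smul (γ.hasDerivAt s)).sub
      ((Real.hasDerivAt_sinh s).smul (γ.hasDerivAt_deriv s))).congr_deriv ?_
    module
  have h2 : ∀ s, HasDerivAt (fun s => Real.cosh s • deriv γ s - Real.sinh s • γ s) 0 s := by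
    intro s
    refine (((Real.hasDerivAt_cosh s).smul (γ.hasDerivAt_deriv s)).sub
      ((Real.hasDerivAt_sinh s).smul (γ.hasDerivAt s))).congr_deriv ?_
    module
  have k1 := is_const_of_deriv_eq_zero (fun s => (h1 s).differentiableAt)
    (fun s => (h1 s).deriv) t 0
  have k2 := is_const_of_deriv_eq_zero (fun s => (h2 s).differentiableAt)
    (fun s => (h2 s).deriv) t 0
  simp only [Real.cosh_zero, Real.sinh_zero, one_smul, zero_smul, sub_zero] at k1 k2
  rw [hyp, ← k1, ← k2]
  have hc : γ t = (Real.cosh t ^ 2 - Real.sinh t ^ 2) • γ t := by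
    rw [Real.cosh_sq]; simp
  conv_lhs => rw [hc]
  module

@[ext] theorem ext' {γ σ : Geod} (h : ∀ t, γ t = σ t) : γ = σ := by
  cases γ; cases σ
  simp only [mk.injEq]
  exact funext h

theorem eq_geod {q w : Mink} (h : UnitTangent q w) (h0 : γ 0 = q) (h1 : deriv γ 0 = w) :
    γ = h.geod := by
  ext t : 1
  rw [γ.eq_hyp, h0, h1, h.geod_apply]

end Geod

/-- The oriented line with given initial data. -/
def UnitTangent.line {q w : Mink} (h : UnitTangent q w) : OrLine := Quotient.mk geodSetoid h.geod

namespace UnitTangent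

variable {q w : Mink}

theorem represents_iff (h : UnitTangent q w) (γ : Geod) :
    γ.Represents h.line ↔ ∃ s, γ = (h.at_time s).geod := by
  rw [Geod.Represents, line, Quotient.eq]
  constructor
  · rintro ⟨s, hs⟩
    refine ⟨-s, Geod.ext' fun t => ?_⟩
    have := hs (-s + t)
    rw [geod_apply] at this
    rw [geod_apply, ← hyp_add, this]
    congr 1; ring
  · rintro ⟨s, rfl⟩
    refine ⟨-s, fun t => ?_⟩
    rw [geod_apply, geod_apply, ← hyp_add]
    congr 1; ring

theorem line_points (h : UnitTangent q w) : h.line.points = Set.range (hyp q w) := by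
  ext x
  constructor
  · rintro ⟨γ, hγ, t, rfl⟩
    obtain ⟨s, rfl⟩ := (h.represents_iff γ).1 hγ
    exact ⟨s + t, by rw [hyp_add]; rfl⟩
  · rintro ⟨t, rfl⟩
    exact ⟨h.geod, rfl, t, rfl⟩

end UnitTangent

/-! ### Distances and feet of perpendiculars -/

theorem hdist_pos {p q : Mink} (hp : p ∈ H3) (hq : q ∈ H3) (h : p ≠ q) : 0 < hdist p q :=
  Real.arcosh_pos (one_lt_neg_lor hp hq h)

theorem one_le_neg_lor {p q : Mink} (hp : p ∈ H3) (hq : q ∈ H3) : 1 ≤ -lor p q := by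
  by_cases h : p = q
  · rw [h, hq.1]; norm_num
  · exact (one_lt_neg_lor hp hq h).le

theorem cosh_hdist {p q : Mink} (hp : p ∈ H3) (hq : q ∈ H3) :
    Real.cosh (hdist p q) = -lor p q :=
  Real.cosh_arcosh (one_le_neg_lor hp hq)

/-- The foot of the perpendicular is the unique nearest point. -/
theorem UnitTangent.isFoot_iff {q w : Mink} (h : UnitTangent q w) {p : Mink} (hp : p ∈ H3)
    (t : ℝ) (ht : lor (hypVel q w t) p = 0) (x : Mink) :
    IsFoot h.line p x ↔ x = hyp q w t := by
  -- The hyperbolic Pythagorean theorem for the right angle at time t.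
  have hd : ∀ s, -lor (hyp q w s) p = Real.cosh (s - t) * -lor (hyp q w t) p := by
    intro s
    have : hyp q w s = hyp (hyp q w t) (hypVel q w t) (s - t) := by
      rw [← hyp_add]; congr 1; ring
    rw [this, hyp, lor_add_left, lor_smul_left, lor_smul_left, ht]
    ring
  have hn := lor_neg (h.at_time t).mem hp
  have mono : ∀ s s', hdist (hyp q w s) p ≤ hdist (hyp q w s') p ↔
      Real.cosh (s - t) ≤ Real.cosh (s' - t) := by
    intro s s'
    have h1 := cosh_hdist (h.at_time s).mem hp
    have h2 := cosh_hdist (h.at_time s').mem hp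
    have h3 : 0 ≤ hdist (hyp q w s) p :=
      Real.arcosh_nonneg (one_le_neg_lor (h.at_time s).mem hp)
    have h4 : 0 ≤ hdist (hyp q w s') p :=
      Real.arcosh_nonneg (one_le_neg_lor (h.at_time s').mem hp)
    rw [← abs_of_nonneg h3, ← abs_of_nonneg h4, ← Real.cosh_le_cosh, h1, h2, hd s, hd s',
      mul_le_mul_iff_left₀ (by linarith)]
  rw [IsFoot, h.line_points]
  constructor
  · rintro ⟨⟨s, rfl⟩, hs⟩
    have := (mono s t).1 (hs _ ⟨t, rfl⟩)
    rw [sub_self, Real.cosh_le_cosh, abs_zero] at this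
    rw [sub_eq_zero.1 (abs_nonpos_iff.1 this)]
  · rintro rfl
    refine ⟨⟨t, rfl⟩, ?_⟩
    rintro _ ⟨s, rfl⟩
    rw [mono, sub_self, Real.cosh_zero]
    exact Real.one_le_cosh _

/-! ### Joining geodesics and parallel fields -/

/-- The initial velocity at `q` of the geodesic from `q` to `p`. -/
def dir (q p : Mink) : Mink :=
  (Real.sinh (hdist q p))⁻¹ • (p - Real.cosh (hdist q p) • q)

theorem sinh_hdist_pos {q p : Mink} (hq : q ∈ H3) (hp : p ∈ H3) (hne : q ≠ p) :
    0 < Real.sinh (hdist q p) := Real.sinh_pos_iff.2 (hdist_pos hq hp hne)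

theorem unitTangent_dir {q p : Mink} (hq : q ∈ H3) (hp : p ∈ H3) (hne : q ≠ p) :
    UnitTangent q (dir q p) := by
  have hs := (sinh_hdist_pos hq hp hne).ne'
  have hc := cosh_hdist hq hp
  have hsq := Real.cosh_sq (hdist q p)
  refine ⟨hq, ?_, ?_⟩
  · rw [dir, lor_smul_right, lor_sub_right, lor_smul_right, hq.1, hc]; ring
  · rw [dir, lor_smul_left, lor_smul_right, lor_sub_left, lor_sub_right, lor_sub_right,
      lor_smul_left, lor_smul_right, lor_smul_left, lor_smul_right, hq.1, hp.1, lor_comm p q,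
      show lor q p = -Real.cosh (hdist q p) by rw [hc]; ring]
    field_simp
    linear_combination hsq

theorem hyp_dir {q p : Mink} (hq : q ∈ H3) (hp : p ∈ H3) (hne : q ≠ p) :
    hyp q (dir q p) (hdist q p) = p := by
  have hs := (sinh_hdist_pos hq hp hne).ne'
  rw [hyp, dir, smul_inv_smul₀ hs]
  abel

theorem joins_iff {q p : Mink} (hq : q ∈ H3) (hp : p ∈ H3) (hne : q ≠ p) (σ : Geod) :
    Joins σ q p ↔ σ = (unitTangent_dir hq hp hne).geod := by
  constructor
  · rintro ⟨h0, h1⟩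
    refine σ.eq_geod _ h0 ?_
    have hs := (sinh_hdist_pos hq hp hne).ne'
    rw [σ.eq_hyp, h0, hyp] at h1
    rw [dir, eq_inv_smul_iff₀ hs, eq_sub_iff_add_eq', h1]
  · rintro rfl
    exact ⟨hyp_zero _ _, hyp_dir hq hp hne⟩

theorem isParallel_const {c : ℝ → Mink} {v : Mink} (h : ∀ t, lor (c t) v = 0) :
    IsParallel c fun _ => v :=
  ⟨contDiff_const, h, fun t => by simp [covDeriv, tanProj, lor_zero_right]⟩

/-- A parallel field that is orthogonal to a geodesic at one point is constant. -/
theorem IsParallel.eq_const {γ : Geod} {X : ℝ → Mink} (hX : IsParallel γ X) {t₀ : ℝ}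
    (h : lor (deriv γ t₀) (X t₀) = 0) (t : ℝ) : X t = X t₀ := by
  obtain ⟨hs, ht, hp⟩ := hX
  have hd : ∀ t, HasDerivAt X (deriv X t) t := fun t =>
    (hs.differentiable (by simp) t).hasDerivAt
  have h1 : ∀ t, lor (γ t) (deriv X t) = -lor (deriv γ t) (X t) := by
    intro t
    have := (HasDerivAt.lor (γ.hasDerivAt t) (hd t)).unique
      ((hasDerivAt_const t (0 : ℝ)).congr_of_eventuallyEq (Filter.Eventually.of_forall ht))
    linarith
  have h2 : ∀ t, deriv X t = lor (deriv γ t) (X t) • γ t := by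
    intro t
    have := eq_neg_of_add_eq_zero_left (hp t)
    rw [this, h1]; simp
  have h3 : ∀ t, HasDerivAt (fun t => lor (deriv γ t) (X t)) 0 t := by
    intro t
    refine (HasDerivAt.lor (γ.hasDerivAt_deriv t) (hd t)).congr_deriv ?_
    rw [ht, h2, lor_smul_right, lor_comm (deriv γ t) (γ t), (γ.unitTangent t).orth]; simp
  have h4 : ∀ t, lor (deriv γ t) (X t) = 0 := fun t => by
    rw [← h]
    exact is_const_of_deriv_eq_zero (fun s => (h3 s).differentiableAt) (fun s => (h3 s).deriv) t t₀
  exact is_const_of_deriv_eq_zero (fun s => (hd s).differentiableAt)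
    (fun s => by rw [h2, h4, zero_smul]) t t₀

/-! ### One step of the billiard map -/

theorem lor_hyp_eq_zero {q e v : Mink} (hq : lor q v = 0) (he : lor e v = 0) (t : ℝ) :
    lor (hyp q e t) v = 0 := by
  rw [hyp, lor_add_left, lor_smul_left, lor_smul_left, hq, he]; ring

theorem UnitTangent.hyp_injective {q e : Mink} (h : UnitTangent q e) :
    Function.Injective (hyp q e) := fun s t hst => by
  have : ∀ t, lor (hyp q e t) e = Real.sinh t := fun t => by
    rw [hyp, lor_add_left, lor_smul_left, lor_smul_left, h.orth, h.unit]; ring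
  exact Real.sinh_injective (by rw [← this, ← this, hst])

/-- The determinant of a frame, expanded. -/
theorem frame_det (x u v w : Mink) : (Matrix.of ![x, u, v, w]).det =
    (x 0 * u 1 - x 1 * u 0) * (v 2 * w 3 - v 3 * w 2)
    - (x 0 * u 2 - x 2 * u 0) * (v 1 * w 3 - v 3 * w 1)
    + (x 0 * u 3 - x 3 * u 0) * (v 1 * w 2 - v 2 * w 1)
    + (x 1 * u 2 - x 2 * u 1) * (v 0 * w 3 - v 3 * w 0)
    - (x 1 * u 3 - x 3 * u 1) * (v 0 * w 2 - v 2 * w 0)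
    + (x 2 * u 3 - x 3 * u 2) * (v 0 * w 1 - v 1 * w 0) := by
  simp [Matrix.det_succ_row_zero, Fin.sum_univ_succ, Fin.succAbove]
  ring

theorem frame_det_swap (x u v w : Mink) :
    (Matrix.of ![x, u, v, w]).det = -(Matrix.of ![x, v, u, w]).det := by
  rw [frame_det, frame_det]; ring

/-- Position and velocity at time t arise from q and e by a matrix of determinant cosh² - sinh² = 1,
so orientation need only be tested at one time. -/
theorem frame_det_hyp (q u v e : Mink) (t : ℝ) :
    (Matrix.of ![hyp q e t, u, v, hypVel q e t]).det = (Matrix.of ![q, u, v, e]).det := by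
  have h := Real.cosh_sq t
  simp only [frame_det, hyp, hypVel, Pi.add_apply, Pi.smul_apply, smul_eq_mul]
  set C := Real.cosh t
  set D := Real.sinh t
  linear_combination
   ((q 0 * u 1 - q 1 * u 0) * (v 2 * e 3 - v 3 * e 2)
    - (q 0 * u 2 - q 2 * u 0) * (v 1 * e 3 - v 3 * e 1)
    + (q 0 * u 3 - q 3 * u 0) * (v 1 * e 2 - v 2 * e 1)
    + (q 1 * u 2 - q 2 * u 1) * (v 0 * e 3 - v 3 * e 0)
    - (q 1 * u 3 - q 3 * u 1) * (v 0 * e 2 - v 2 * e 0)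
    + (q 2 * u 3 - q 3 * u 2) * (v 0 * e 1 - v 1 * e 0)) * h

/-- Each initial velocity is a positive multiple of the target point plus a combination of q and e,
which the determinant ignores. This permits testing orientation on the tangency points themselves,
even though their feet differ. -/
theorem frame_det_dir (q a b e : Mink) (t : ℝ) :
    (Matrix.of ![q, dir (hyp q e t) a, dir q b, e]).det =
      (Real.sinh (hdist (hyp q e t) a))⁻¹ * (Real.sinh (hdist q b))⁻¹ *
        (Matrix.of ![q, a, b, e]).det := by
  simp only [frame_det, dir]
  generalize (Real.sinh (hdist (hyp q e t) a))⁻¹ = α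
  generalize (Real.sinh (hdist q b))⁻¹ = β
  generalize Real.cosh (hdist (hyp q e t) a) = α'
  generalize Real.cosh (hdist q b) = β'
  simp only [hyp, Pi.add_apply, Pi.sub_apply, Pi.smul_apply, smul_eq_mul]
  ring

/-- The surface lies on the negative side of its tangent planes. -/
def CompactSurface.Supported (S : CompactSurface) : Prop :=
  ∀ p ∈ S.carrier, ∀ x ∈ S.carrier, x ≠ p → lor (S.normal p) x < 0

/-- The line `t ↦ hyp q e t` is contained in the tangent planes of `S` at `a` and `b`, the point
of the line nearest to `b` is `q`, the point nearest to `a` is `hyp q e d`, and the orientation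
makes `a` the point to the right of the line. -/
structure Step (S : CompactSurface) (q e : Mink) (d : ℝ) (a b : Mink) : Prop where
  tan : UnitTangent q e
  memA : a ∈ S.carrier
  memB : b ∈ S.carrier
  normalA : lor (S.normal a) q = 0 ∧ lor (S.normal a) e = 0
  normalB : lor (S.normal b) q = 0 ∧ lor (S.normal b) e = 0
  footA : lor (hypVel q e d) a = 0
  footB : lor e b = 0
  frame : PosFrame q a b e

namespace Step

variable {S : CompactSurface} {q e : Mink} {d : ℝ} {a b : Mink}

theorem ne (st : Step S q e d a b) : a ≠ b := by
  rintro rfl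
  have := st.frame
  rw [PosFrame, frame_det] at this
  ring_nf at this
  exact lt_irrefl _ this

theorem disjoint (st : Step S q e d a b) (hS : S.Supported) :
    Disjoint st.tan.line.points S.carrier := by
  rw [Set.disjoint_left, st.tan.line_points]
  rintro _ ⟨t, rfl⟩ hx
  have key : ∀ c ∈ S.carrier, lor (S.normal c) q = 0 ∧ lor (S.normal c) e = 0 →
      hyp q e t = c := by
    intro c hc ⟨h1, h2⟩
    by_contra hne
    have := hS c hc _ hx hne
    rw [lor_comm, lor_hyp_eq_zero (by rwa [lor_comm]) (by rwa [lor_comm])] at this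
    exact lt_irrefl _ this
  exact st.ne ((key a st.memA st.normalA).symm.trans (key b st.memB st.normalB))

theorem mem_touchPoints_iff (st : Step S q e d a b) (c : Mink) :
    c ∈ S.touchPoints st.tan.line ↔
      c ∈ S.carrier ∧ lor (S.normal c) q = 0 ∧ lor (S.normal c) e = 0 := by
  rw [CompactSurface.touchPoints, Set.mem_ofPred_eq, st.tan.line_points, Set.range_subset_iff]
  refine and_congr_right fun _ => ⟨fun h => ?_, fun ⟨h1, h2⟩ t => ⟨(st.tan.at_time t).mem, ?_⟩⟩
  · have h0 := (h 0).2
    have h1 := (h 1).2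
    rw [hyp_zero] at h0
    rw [hyp, lor_add_right, lor_smul_right, lor_smul_right, h0, mul_zero, zero_add] at h1
    exact ⟨h0, (mul_eq_zero.1 h1).resolve_left (Real.sinh_pos_iff.2 one_pos).ne'⟩
  · rw [lor_comm, lor_hyp_eq_zero (by rwa [lor_comm]) (by rwa [lor_comm])]

theorem touchPoints_eq (st : Step S q e d a b) (hS : S.Supported) :
    S.touchPoints st.tan.line = {a, b} := by
  ext c
  rw [st.mem_touchPoints_iff]
  constructor
  · rintro ⟨hc, hcq, hce⟩
    by_contra hne
    simp only [Set.mem_insert_iff, Set.mem_singleton_iff, not_or] at hne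
    -- Five vectors in a space of dimension four. Pairing the relation with q and e removes their
    -- coefficients and leaves a relation among the three normals.
    have hdep : ¬ LinearIndependent ℝ ![q, e, S.normal a, S.normal b, S.normal c] := fun h => by
      have := h.fintype_card_le_finrank
      simp at this
    obtain ⟨g, hg, i, hi⟩ := Fintype.not_linearIndependent_iff.1 hdep
    simp only [Fin.sum_univ_five] at hg
    change g 0 • q + g 1 • e + g 2 • S.normal a + g 3 • S.normal b + g 4 • S.normal c = 0 at hg
    have pair : ∀ x, g 0 * lor q x + g 1 * lor e x + g 2 * lor (S.normal a) x +
        g 3 * lor (S.normal b) x + g 4 * lor (S.normal c) x = 0 := by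
      intro x
      have := congrArg (fun y => lor y x) hg
      simpa only [lor_add_left, lor_smul_left, lor_zero_left] using this
    have h0 : g 0 = 0 := by
      have := pair q
      rw [st.tan.mem.1, lor_comm e, st.tan.orth, st.normalA.1, st.normalB.1, hcq] at this
      linarith
    have h1 : g 1 = 0 := by
      have := pair e
      rw [st.tan.unit, st.tan.orth, st.normalA.2, st.normalB.2, hce] at this
      linarith
    have self : ∀ p ∈ S.carrier, lor (S.normal p) p = 0 := fun p hp => by
      rw [lor_comm]; exact S.normal_tangent p hp
    have pa := pair a
    have pb := pair b
    have pc := pair c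
    rw [h0, h1, self a st.memA] at pa
    rw [h0, h1, self b st.memB] at pb
    rw [h0, h1, self c hc] at pc
    have ab := hS a st.memA b st.memB st.ne.symm
    have ba := hS b st.memB a st.memA st.ne
    have ac := hS a st.memA c hc hne.1
    have ca := hS c hc a st.memA (Ne.symm hne.1)
    have bc := hS b st.memB c hc hne.2
    have cb := hS c hc b st.memB (Ne.symm hne.2)
    -- Pairing with a, b or c kills one normal and makes the other two pairings negative. So any two
    -- of the three coefficients have opposite signs or vanish together, which forces all of them to
    -- vanish.
    have sgn : ∀ {x y s t : ℝ}, s < 0 → t < 0 → x * s + y * t = 0 →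
        (0 < x → y < 0) ∧ (x < 0 → 0 < y) ∧ (x = 0 → y = 0) := by
      intro x y s t hs ht h
      refine ⟨fun hx => ?_, fun hx => ?_, fun hx => ?_⟩
      · by_contra hy
        nlinarith [mul_neg_of_pos_of_neg hx hs, mul_nonneg (not_lt.1 hy) (neg_pos.2 ht).le]
      · by_contra hy
        nlinarith [mul_pos_of_neg_of_neg hx hs, mul_nonneg_of_nonpos_of_nonpos (not_lt.1 hy) ht.le]
      · rw [hx, zero_mul, zero_add] at h
        exact (mul_eq_zero.1 h).resolve_right ht.ne
    have s1 := sgn (x := g 3) (y := g 4) ba ca (by linarith)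
    have s2 := sgn (x := g 2) (y := g 4) ab cb (by linarith)
    have s3 := sgn (x := g 2) (y := g 3) ac bc (by linarith)
    rcases lt_trichotomy (g 2) 0 with h | h | h
    · have h3 := s3.2.1 h
      have h4 := s2.2.1 h
      linarith [s1.1 h3]
    · have h3 := s3.2.2 h
      have h4 := s2.2.2 h
      fin_cases i <;> simp_all
    · have h3 := s3.1 h
      have h4 := s2.1 h
      linarith [s1.2.1 h3]
  · rintro (rfl | rfl)
    · exact ⟨st.memA, st.normalA⟩
    · exact ⟨st.memB, st.normalB⟩

theorem hyp_ne (st : Step S q e d a b) (hS : S.Supported) (t : ℝ) {c : Mink}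
    (hc : c ∈ S.carrier) : hyp q e t ≠ c := by
  rintro rfl
  refine Set.disjoint_left.1 (st.disjoint hS) ?_ hc
  rw [st.tan.line_points]
  exact ⟨t, rfl⟩

theorem q_ne (st : Step S q e d a b) (hS : S.Supported) : q ≠ b := by
  have := st.hyp_ne hS 0 st.memB
  rwa [hyp_zero] at this

theorem isFoot_a (st : Step S q e d a b) (x : Mink) :
    IsFoot st.tan.line a x ↔ x = hyp q e d :=
  st.tan.isFoot_iff (S.subset_H3 st.memA) d st.footA x

theorem isFoot_b (st : Step S q e d a b) (x : Mink) : IsFoot st.tan.line b x ↔ x = q := by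
  have := st.tan.isFoot_iff (S.subset_H3 st.memB) 0 (by rw [hypVel_zero, st.footB]) x
  rwa [hyp_zero] at this

theorem dirA (st : Step S q e d a b) (hS : S.Supported) :
    UnitTangent (hyp q e d) (dir (hyp q e d) a) :=
  unitTangent_dir (st.tan.at_time d).mem (S.subset_H3 st.memA) (st.hyp_ne hS d st.memA)

theorem dirB (st : Step S q e d a b) (hS : S.Supported) : UnitTangent q (dir q b) :=
  unitTangent_dir st.tan.mem (S.subset_H3 st.memB) (st.q_ne hS)

theorem lor_dirA (st : Step S q e d a b) :
    lor (hypVel q e d) (dir (hyp q e d) a) = 0 := by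
  rw [dir, lor_smul_right, lor_sub_right, lor_smul_right, st.footA, lor_comm (hypVel q e d),
    (st.tan.at_time d).orth]
  ring

theorem lor_dirB (st : Step S q e d a b) : lor e (dir q b) = 0 := by
  rw [dir, lor_smul_right, lor_sub_right, lor_smul_right, st.footB, lor_comm e, st.tan.orth]
  ring

theorem frame_dir (st : Step S q e d a b) (hS : S.Supported) :
    PosFrame q (dir (hyp q e d) a) (dir q b) e := by
  rw [PosFrame, frame_det_dir]
  have h1 := sinh_hdist_pos (st.tan.at_time d).mem (S.subset_H3 st.memA) (st.hyp_ne hS d st.memA)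
  have h2 := sinh_hdist_pos st.tan.mem (S.subset_H3 st.memB) (st.q_ne hS)
  have h3 := st.frame
  rw [PosFrame] at h3
  positivity

theorem isConfig (st : Step S q e d a b) (hS : S.Supported) :
    IsConfig S st.tan.line a b (hyp q e d) q where
  touch := st.touchPoints_eq hS
  foot_plus := (st.isFoot_a _).2 rfl
  foot_minus := (st.isFoot_b _).2 rfl
  right_left := by
    refine ⟨st.tan.geod, (st.dirA hS).geod, (st.dirB hS).geod, d, 0, fun _ => dir (hyp q e d) a,
      fun _ => dir q b, rfl, rfl, hyp_zero _ _,
      (joins_iff (st.tan.at_time d).mem (S.subset_H3 st.memA) (st.hyp_ne hS d st.memA) _).2 rfl,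
      (joins_iff st.tan.mem (S.subset_H3 st.memB) (st.q_ne hS) _).2 rfl,
      isParallel_const fun t => ?_, ?_, isParallel_const fun t => ?_, ?_, fun t => ?_⟩
    · have : hyp q e t = hyp (hyp q e d) (hypVel q e d) (t - d) := by
        rw [← hyp_add]; congr 1; ring
      change lor (hyp q e t) _ = 0
      rw [this]
      exact lor_hyp_eq_zero (st.dirA hS).orth st.lor_dirA _
    · rw [UnitTangent.deriv_geod, hypVel_zero]
    · exact lor_hyp_eq_zero (st.dirB hS).orth st.lor_dirB _
    · rw [UnitTangent.deriv_geod, hypVel_zero]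
    · rw [UnitTangent.deriv_geod, UnitTangent.geod_apply, PosFrame, frame_det_hyp]
      exact st.frame_dir hS

/-- Both parallel fields are orthogonal to the line, hence constant; exchanging them changes the
sign of the determinant. This is what makes the labels plus and minus unambiguous. -/
theorem not_rightLeft_swap (st : Step S q e d a b) (hS : S.Supported) :
    ¬ RightLeft st.tan.line b a q (hyp q e d) := by
  rintro ⟨γ, σ, τ, s, t, V, W, hγ, hs, ht, hσ, hτ, hV, hV0, hW, hW0, hpos⟩
  obtain ⟨u, rfl⟩ := (st.tan.represents_iff γ).1 hγ
  rw [joins_iff st.tan.mem (S.subset_H3 st.memB) (st.q_ne hS)] at hσ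
  rw [joins_iff (st.tan.at_time d).mem (S.subset_H3 st.memA) (st.hyp_ne hS d st.memA)] at hτ
  subst hσ hτ
  rw [UnitTangent.deriv_geod, hypVel_zero] at hV0 hW0
  rw [UnitTangent.geod_apply, ← hyp_add] at hs ht
  have hs' : u + s = 0 := st.tan.hyp_injective (by rw [hs, hyp_zero])
  have ht' : u + t = d := st.tan.hyp_injective ht
  have cV := hV.eq_const (t₀ := s) (by
    rw [UnitTangent.deriv_geod, ← hypVel_add, hs', hypVel_zero, hV0]; exact st.lor_dirB)
  have cW := hW.eq_const (t₀ := t) (by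
    rw [UnitTangent.deriv_geod, ← hypVel_add, ht', hW0]; exact st.lor_dirA)
  have h := hpos s
  rw [cV, cW, hV0, hW0, UnitTangent.deriv_geod, UnitTangent.geod_apply, ← hypVel_add, ← hyp_add,
    hs', hyp_zero, hypVel_zero, PosFrame, frame_det_swap] at h
  have h' := st.frame_dir hS
  rw [PosFrame] at h'
  linarith

theorem config_unique (st : Step S q e d a b) (hS : S.Supported) {a' b' x y : Mink}
    (h : IsConfig S st.tan.line a' b' x y) :
    a' = a ∧ b' = b ∧ x = hyp q e d ∧ y = q := by
  have ht := h.touch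
  rw [st.touchPoints_eq hS, Set.pair_eq_pair_iff] at ht
  rcases ht with ⟨rfl, rfl⟩ | ⟨rfl, rfl⟩
  · exact ⟨rfl, rfl, (st.isFoot_a _).1 h.foot_plus, (st.isFoot_b _).1 h.foot_minus⟩
  · obtain rfl := (st.isFoot_b _).1 h.foot_plus
    obtain rfl := (st.isFoot_a _).1 h.foot_minus
    exact absurd h.right_left (st.not_rightLeft_swap hS)

/-- Travelling twice the distance to p is the point reflection at p. -/
theorem hyp_dir_two_mul {q p : Mink} (hq : q ∈ H3) (hp : p ∈ H3) (hne : q ≠ p) :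
    hyp q (dir q p) (2 * hdist q p) = -q - (2 * lor q p) • p := by
  have hs := (sinh_hdist_pos hq hp hne).ne'
  have hc : lor q p = -Real.cosh (hdist q p) := by rw [cosh_hdist hq hp]; ring
  rw [hyp, dir, hc, Real.cosh_two_mul, Real.sinh_two_mul, smul_smul, Real.sinh_sq,
    show 2 * Real.sinh (hdist q p) * Real.cosh (hdist q p) * (Real.sinh (hdist q p))⁻¹ =
      2 * Real.cosh (hdist q p) by field_simp]
  module

/-- The line is orthogonal to the joining geodesic, so its transported velocity is the same ambient
vector, while the foot is reflected at a. Uniqueness of the configuration, the joining geodesic and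
the parallel field gives the forward direction. -/
theorem isImage_iff (st : Step S q e d a b) (hS : S.Supported) {q' : Mink}
    (h' : UnitTangent q' (hypVel q e d))
    (hq' : q' = -hyp q e d - (2 * lor (hyp q e d) a) • a) (ℓ' : OrLine) :
    IsImage S st.tan.line ℓ' ↔ ℓ' = h'.line := by
  have hm := (st.tan.at_time d).mem
  have ha := S.subset_H3 st.memA
  have hne := st.hyp_ne hS d st.memA
  constructor
  · rintro ⟨a', b', x, y, σ, hc, hσ, γ, γ', X, hγ, hγ', hX, h0, h1, h2, h3⟩
    obtain ⟨rfl, rfl, rfl, rfl⟩ := st.config_unique hS hc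
    obtain rfl := (joins_iff hm ha hne σ).1 hσ
    obtain ⟨s, rfl⟩ := (st.tan.represents_iff γ).1 hγ
    rw [UnitTangent.geod_apply, UnitTangent.geod_apply, hyp_zero, hyp_zero] at h0
    obtain rfl := st.tan.hyp_injective h0
    rw [UnitTangent.deriv_geod, hypVel_zero] at h1
    have hcX := hX.eq_const (t₀ := 0) (by
      rw [UnitTangent.deriv_geod, hypVel_zero, ← h1, lor_comm]; exact st.lor_dirA)
    rw [hcX, ← h1] at h3
    rw [UnitTangent.geod_apply, hyp_dir_two_mul hm ha hne, ← hq'] at h2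
    rw [← hγ', γ'.eq_geod h' h2 h3]
    rfl
  · rintro rfl
    refine ⟨a, b, hyp q e d, q, (st.dirA hS).geod, st.isConfig hS, (joins_iff hm ha hne _).2 rfl,
      (st.tan.at_time d).geod, h'.geod, fun _ => hypVel q e d, (st.tan.represents_iff _).2 ⟨d, rfl⟩,
      rfl, isParallel_const fun t => lor_hyp_eq_zero (st.tan.at_time d).orth ?_ t, ?_, ?_, ?_, ?_⟩
    · rw [lor_comm]; exact st.lor_dirA
    · rw [UnitTangent.geod_apply, UnitTangent.geod_apply, hyp_zero, hyp_zero]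
    · rw [UnitTangent.deriv_geod, hypVel_zero]
    · rw [UnitTangent.geod_apply, UnitTangent.geod_apply, hyp_zero, hyp_dir_two_mul hm ha hne, hq']
    · rw [UnitTangent.deriv_geod, hypVel_zero]

/-- The table element of a step. -/
def table (st : Step S q e d a b) (hS : S.Supported) : S.Table :=
  ⟨st.tan.line, st.disjoint hS⟩

theorem outerBilliard_eq (st : Step S q e d a b) (hS : S.Supported) {q' e' : Mink} {d' : ℝ}
    {a' : Mink} (st' : Step S q' e' d' a' a) (he' : e' = hypVel q e d)
    (hq' : q' = -hyp q e d - (2 * lor (hyp q e d) a) • a) :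
    outerBilliard S (st.table hS) = st'.table hS := by
  subst he'
  have h : ∀ ℓ' : S.Table, IsImage S (st.table hS).1 ℓ'.1 ↔ ℓ' = st'.table hS := fun ℓ' =>
    (st.isImage_iff hS st'.tan hq' ℓ'.1).trans (Subtype.ext_iff (a2 := st'.table hS)).symm
  -- Unique existence selects the genuine branch in the definition of the map rather than its dummy
  -- value.
  have hex : ∃! ℓ' : S.Table, IsImage S (st.table hS).1 ℓ'.1 :=
    ⟨st'.table hS, (h _).2 rfl, fun ℓ' => (h ℓ').1⟩
  rw [outerBilliard, dif_pos hex]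
  exact (h _).1 hex.choose_spec.1

theorem isSignedDist (st : Step S q e d a b) (hS : S.Supported) :
    IsSignedDist S (st.table hS).1 d :=
  ⟨a, b, hyp q e d, q, st.tan.geod, st.isConfig hS, rfl, hyp_zero _ _, rfl⟩

end Step

/-! ### Surfaces given by an equation -/

/-- The Lorentz gradient of a function. -/
def grad (G : Mink → ℝ) (x : Mink) : Mink :=
  ![-fderiv ℝ G x (Pi.single 0 1), fderiv ℝ G x (Pi.single 1 1), fderiv ℝ G x (Pi.single 2 1),
    fderiv ℝ G x (Pi.single 3 1)]

theorem lor_grad (G : Mink → ℝ) (x v : Mink) : lor (grad G x) v = fderiv ℝ G x v := by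
  have hv : v = v 0 • Pi.single 0 1 + v 1 • Pi.single 1 1 + v 2 • Pi.single 2 1
      + v 3 • (Pi.single 3 1 : Mink) := by
    ext i; fin_cases i <;> simp
  conv_rhs => rw [hv]
  simp only [map_add, map_smul, smul_eq_mul, lor, grad]
  simp
  ring

theorem contDiff_grad {G : Mink → ℝ} (hG : ContDiff ℝ ∞ G) : ContDiff ℝ ∞ (grad G) := by
  have h : ∀ v, ContDiff ℝ ∞ fun x => fderiv ℝ G x v := fun v =>
    (hG.fderiv_right (m := ∞) (by simp)).clm_apply contDiff_const
  refine contDiff_pi.2 fun i => ?_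
  fin_cases i
  · exact (h _).neg
  · exact h _
  · exact h _
  · exact h _

/-- A function that defines a quadratically convex surface in `H3`. -/
structure ConvexEquation (G : Mink → ℝ) : Prop where
  smooth : ContDiff ℝ ∞ G
  compact : IsCompact {x | x ∈ H3 ∧ G x = 0}
  connected : IsConnected {x | x ∈ H3 ∧ G x = 0}
  radial : ∀ p ∈ H3, G p = 0 → fderiv ℝ G p p = 0
  regular : ∀ p ∈ H3, G p = 0 → fderiv ℝ G p ≠ 0
  support : ∀ p ∈ H3, G p = 0 → ∀ x ∈ H3, G x = 0 → x ≠ p → fderiv ℝ G p x < 0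
  hessian : ∀ p ∈ H3, G p = 0 → ∀ v, v ≠ 0 → lor p v = 0 → fderiv ℝ G p v = 0 →
    0 < fderiv ℝ (fun x => fderiv ℝ G x v) p v

namespace ConvexEquation

variable {G : Mink → ℝ}

/-- The radial condition makes the Lorentz gradient tangent to the hyperboloid, hence spacelike. -/
theorem grad_pos (hG : ConvexEquation G) {p : Mink} (hp : p ∈ H3) (h0 : G p = 0) :
    0 < lor (grad G p) (grad G p) := by
  refine lor_self_pos hp.1 (by rw [lor_comm, lor_grad, hG.radial p hp h0]) fun h => ?_
  refine hG.regular p hp h0 (ContinuousLinearMap.ext fun v => ?_)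
  rw [← lor_grad, h, lor_zero_left]; rfl

theorem contDiff_lor_grad (hG : ConvexEquation G) :
    ContDiff ℝ ∞ fun x => lor (grad G x) (grad G x) := by
  have h := contDiff_pi.1 (contDiff_grad hG.smooth)
  exact ((((h 0).mul (h 0)).neg.add ((h 1).mul (h 1))).add ((h 2).mul (h 2))).add
    ((h 3).mul (h 3))

theorem contDiffAt_inv_sqrt (hG : ConvexEquation G) {p : Mink} (h : 0 < lor (grad G p) (grad G p)) :
    ContDiffAt ℝ ∞ (fun x => (√(lor (grad G x) (grad G x)))⁻¹) p :=
  (hG.contDiff_lor_grad.contDiffAt.sqrt h.ne').inv (Real.sqrt_pos.2 h).ne'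

/-- The surface in `H3` with equation `G = 0`. -/
def surface (hG : ConvexEquation G) : CompactSurface where
  carrier := {x | x ∈ H3 ∧ G x = 0}
  normal x := (√(lor (grad G x) (grad G x)))⁻¹ • grad G x
  subset_H3 := fun _ h => h.1
  isCompact := hG.compact
  isConnected := hG.connected
  regular p hp := by
    have hpos := Real.sqrt_pos.2 (hG.grad_pos hp.1 hp.2)
    refine ⟨Set.univ, isOpen_univ, trivial, G, hG.smooth.contDiffOn, ?_,
      √(lor (grad G p) (grad G p)), hpos.ne', fun v _ => ?_⟩
    · ext x; simp
    · rw [lor_smul_left, lor_grad G p v, mul_inv_cancel_left₀ hpos.ne']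
  normal_smooth := by
    refine ⟨{x | 0 < lor (grad G x) (grad G x)},
      isOpen_lt continuous_const hG.contDiff_lor_grad.continuous,
      fun p hp => hG.grad_pos hp.1 hp.2, fun p hp => ?_⟩
    exact ((hG.contDiffAt_inv_sqrt hp).smul (contDiff_grad hG.smooth).contDiffAt).contDiffWithinAt
  normal_tangent p hp := by
    rw [lor_smul_right, lor_comm p, lor_grad G p p, hG.radial p hp.1 hp.2, mul_zero]
  normal_unit p hp := by
    have h := hG.grad_pos hp.1 hp.2
    have h2 := Real.mul_self_sqrt h.le
    rw [lor_smul_left, lor_smul_right, ← mul_assoc, ← mul_inv, h2, inv_mul_cancel₀ h.ne']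

theorem lor_normal (hG : ConvexEquation G) (p v : Mink) : lor (hG.surface.normal p) v =
    (√(lor (grad G p) (grad G p)))⁻¹ * fderiv ℝ G p v := by
  rw [← lor_grad, ← lor_smul_left]; rfl

theorem supported (hG : ConvexEquation G) : hG.surface.Supported := by
  intro p hp x hx hne
  rw [lor_normal]
  exact mul_neg_of_pos_of_neg (inv_pos.2 (Real.sqrt_pos.2 (hG.grad_pos hp.1 hp.2)))
    (hG.support p hp.1 hp.2 x hx.1 hx.2 hne)

theorem lor_normal_eq_zero_iff (hG : ConvexEquation G) {p : Mink}
    (hp : p ∈ hG.surface.carrier) (v : Mink) :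
    lor (hG.surface.normal p) v = 0 ↔ fderiv ℝ G p v = 0 := by
  have := (inv_pos.2 (Real.sqrt_pos.2 (hG.grad_pos hp.1 hp.2))).ne'
  rw [lor_normal, mul_eq_zero, or_iff_right this]

theorem strictlyConvex (hG : ConvexEquation G) : hG.surface.StrictlyConvex := by
  intro p hp
  ext x
  constructor
  · rintro ⟨⟨-, h⟩, hx⟩
    by_contra hne
    exact (hG.supported p hp x hx hne).ne h
  · rintro rfl
    exact ⟨⟨hp.1, by rw [lor_comm]; exact hG.surface.normal_tangent x hp⟩, hp⟩

/-- The derivative of a Lorentz product with a constant vector. -/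
theorem lor_fderiv {N : Mink → Mink} {p : Mink} (hN : DifferentiableAt ℝ N p) (v w : Mink) :
    lor (fderiv ℝ N p v) w = fderiv ℝ (fun x => lor (N x) w) p v := by
  have h := hasFDerivAt_pi'.1 hN.hasFDerivAt
  have h2 := ((((h 0).mul_const (w 0)).neg.add ((h 1).mul_const (w 1))).add
    ((h 2).mul_const (w 2))).add ((h 3).mul_const (w 3))
  have h3 : fderiv ℝ (fun x => lor (N x) w) p = _ := h2.fderiv
  rw [h3]
  simp only [lor, add_apply, neg_apply,
    smul_apply, smul_eq_mul, ContinuousLinearMap.comp_apply,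
    ContinuousLinearMap.proj_apply]
  ring

/-- The normal is a scalar function times the gradient. On a tangent vector the derivative of the
scalar is multiplied by dG(v) = 0, so the second fundamental form is a negative multiple of the
Hessian of G. -/
theorem quadraticallyConvex (hG : ConvexEquation G) : hG.surface.QuadraticallyConvex := by
  refine ⟨hG.strictlyConvex, fun p hp => Or.inr ?_⟩
  rintro v ⟨hpv, hnv⟩ hv
  rw [lor_normal_eq_zero_iff hG hp] at hnv
  have hpos := hG.grad_pos hp.1 hp.2
  have hκ := (hG.contDiffAt_inv_sqrt hpos).differentiableAt (by simp)
  have hN : DifferentiableAt ℝ hG.surface.normal p :=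
    hκ.smul ((contDiff_grad hG.smooth).differentiable (by simp) p)
  have hF : DifferentiableAt ℝ (fun x => fderiv ℝ G x v) p :=
    (((hG.smooth.fderiv_right (m := ∞) (by simp)).clm_apply contDiff_const).differentiable
      (by simp)) p
  have h1 : lor (fderiv ℝ hG.surface.normal p v) v =
      (√(lor (grad G p) (grad G p)))⁻¹ * fderiv ℝ (fun x => fderiv ℝ G x v) p v := by
    rw [lor_fderiv hN]
    simp only [lor_normal]
    rw [fderiv_fun_mul hκ hF]
    simp [hnv]
  rw [CompactSurface.shape, tanProj, lor_neg_left, lor_add_left, lor_smul_left, hpv, mul_zero,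
    add_zero, h1, neg_lt_zero]
  exact mul_pos (inv_pos.2 (Real.sqrt_pos.2 hpos)) (hG.hessian p hp.1 hp.2 v hv hpv hnv)

end ConvexEquation

/-! ### A convex quartic -/

/-- A linear form that is invariant, up to the signs `s` and `t`, under the rotations by `π` about
the coordinate axes. -/
def facet (s t : ℝ) (x : Mink) : ℝ :=
  x 0 + s * (2 * x 1) + t * (30 / 11 * x 2) + s * t * (5 / 4 * x 3)

/-- A positive quadratic form in the space coordinates. -/
def spaceForm (x y : Mink) : ℝ :=
  15 * (x 1 * y 1) + 85 / 121 * (x 2 * y 2) + 945 / 32 * (x 3 * y 3)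

/-- The homogeneous quartic that defines the surface. -/
def quartic (x : Mink) : ℝ :=
  facet 1 1 x ^ 4 + facet 1 (-1) x ^ 4 + facet (-1) 1 x ^ 4 + facet (-1) (-1) x ^ 4
    + x 0 ^ 2 * spaceForm x x - 2187 / 64 * x 0 ^ 4

/-- The derivative of `quartic`. -/
def quarticDeriv (x y : Mink) : ℝ :=
  4 * (facet 1 1 x ^ 3 * facet 1 1 y + facet 1 (-1) x ^ 3 * facet 1 (-1) y
    + facet (-1) 1 x ^ 3 * facet (-1) 1 y + facet (-1) (-1) x ^ 3 * facet (-1) (-1) y)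
    + 2 * (x 0 * y 0) * spaceForm x x + 2 * x 0 ^ 2 * spaceForm x y
    - 2187 / 16 * (x 0 ^ 3 * y 0)

/-- The second derivative of `quartic`. -/
def quarticHess (x y : Mink) : ℝ :=
  12 * (facet 1 1 x ^ 2 * facet 1 1 y ^ 2 + facet 1 (-1) x ^ 2 * facet 1 (-1) y ^ 2
    + facet (-1) 1 x ^ 2 * facet (-1) 1 y ^ 2 + facet (-1) (-1) x ^ 2 * facet (-1) (-1) y ^ 2)
    + 2 * y 0 ^ 2 * spaceForm x x + 8 * (x 0 * y 0) * spaceForm x y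
    + 2 * x 0 ^ 2 * spaceForm y y - 6561 / 16 * (x 0 ^ 2 * y 0 ^ 2)

theorem facet_add (s t : ℝ) (x y : Mink) : facet s t (x + y) = facet s t x + facet s t y := by
  simp only [facet, Pi.add_apply]; ring

theorem facet_smul (s t a : ℝ) (x : Mink) : facet s t (a • x) = a * facet s t x := by
  simp only [facet, Pi.smul_apply, smul_eq_mul]; ring

theorem spaceForm_comm (x y : Mink) : spaceForm x y = spaceForm y x := by
  simp only [spaceForm]; ring

theorem spaceForm_add_left (x y z : Mink) :
    spaceForm (x + y) z = spaceForm x z + spaceForm y z := by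
  simp only [spaceForm, Pi.add_apply]; ring

theorem spaceForm_smul_left (a : ℝ) (x z : Mink) : spaceForm (a • x) z = a * spaceForm x z := by
  simp only [spaceForm, Pi.smul_apply, smul_eq_mul]; ring

theorem spaceForm_add_right (x y z : Mink) :
    spaceForm x (y + z) = spaceForm x y + spaceForm x z := by
  simp only [spaceForm, Pi.add_apply]; ring

theorem spaceForm_smul_right (a : ℝ) (x z : Mink) : spaceForm x (a • z) = a * spaceForm x z := by
  simp only [spaceForm, Pi.smul_apply, smul_eq_mul]; ring

theorem spaceForm_self_pos {x : Mink} (h0 : x 0 = 0) (hx : x ≠ 0) : 0 < spaceForm x x := by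
  by_contra h
  rw [spaceForm] at h
  have h1 : x 1 = 0 := by nlinarith [sq_nonneg (x 1), sq_nonneg (x 2), sq_nonneg (x 3)]
  have h2 : x 2 = 0 := by nlinarith [sq_nonneg (x 1), sq_nonneg (x 2), sq_nonneg (x 3)]
  have h3 : x 3 = 0 := by nlinarith [sq_nonneg (x 1), sq_nonneg (x 2), sq_nonneg (x 3)]
  exact hx (by ext i; fin_cases i <;> assumption)

theorem spaceForm_self_nonneg (x : Mink) : 0 ≤ spaceForm x x := by
  rw [spaceForm]; nlinarith [sq_nonneg (x 1), sq_nonneg (x 2), sq_nonneg (x 3)]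

theorem contDiff_quartic : ContDiff ℝ ∞ quartic := by
  unfold quartic facet spaceForm
  fun_prop

theorem differentiable_quarticDeriv (v : Mink) : Differentiable ℝ fun x => quarticDeriv x v := by
  unfold quarticDeriv facet spaceForm
  fun_prop

theorem fderiv_apply_of_line {f : Mink → ℝ} {x v : Mink} {L : ℝ} (hf : DifferentiableAt ℝ f x)
    (h : HasDerivAt (fun t : ℝ => f (x + t • v)) L 0) : fderiv ℝ f x v = L := by
  rw [← hf.lineDeriv_eq_fderiv, lineDeriv, h.deriv]

theorem hasDerivAt_affine (a b : ℝ) : HasDerivAt (fun t : ℝ => a + t * b) b 0 := by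
  simpa using ((hasDerivAt_id (0 : ℝ)).mul_const b).const_add a

theorem fderiv_quartic (x v : Mink) : fderiv ℝ quartic x v = quarticDeriv x v := by
  refine fderiv_apply_of_line (contDiff_quartic.differentiable (by simp) x) ?_
  simp only [quartic, facet_add, facet_smul, spaceForm_add_left, spaceForm_add_right,
    spaceForm_smul_left, spaceForm_smul_right, Pi.add_apply, Pi.smul_apply, smul_eq_mul]
  have A := fun s t => (hasDerivAt_affine (facet s t x) (facet s t v)).pow 4
  have X := hasDerivAt_affine (x 0) (v 0)
  have B := (hasDerivAt_affine (spaceForm x x) (spaceForm v x)).add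
    ((hasDerivAt_id (0 : ℝ)).mul (hasDerivAt_affine (spaceForm x v) (spaceForm v v)))
  have H := (((((A 1 1).add (A 1 (-1))).add (A (-1) 1)).add (A (-1) (-1))).add
    ((X.pow 2).mul B)).sub ((X.pow 4).const_mul (2187 / 64))
  refine (H.congr_deriv ?_).congr_of_eventuallyEq (Filter.Eventually.of_forall fun t => ?_)
  · simp only [quarticDeriv, Pi.add_apply, Pi.mul_apply, Pi.pow_apply, id, spaceForm_comm v x]
    push_cast
    ring
  · simp only [Pi.add_apply, Pi.mul_apply, Pi.sub_apply, Pi.pow_apply, id]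

theorem fderiv_quarticDeriv (x v : Mink) :
    fderiv ℝ (fun y => quarticDeriv y v) x v = quarticHess x v := by
  refine fderiv_apply_of_line (differentiable_quarticDeriv v x) ?_
  simp only [quarticDeriv, facet_add, facet_smul, spaceForm_add_left, spaceForm_add_right,
    spaceForm_smul_left, spaceForm_smul_right, Pi.add_apply, Pi.smul_apply, smul_eq_mul]
  have A := fun s t => ((hasDerivAt_affine (facet s t x) (facet s t v)).pow 3).mul_const
    (facet s t v)
  have X := hasDerivAt_affine (x 0) (v 0)
  have B := (hasDerivAt_affine (spaceForm x x) (spaceForm v x)).add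
    ((hasDerivAt_id (0 : ℝ)).mul (hasDerivAt_affine (spaceForm x v) (spaceForm v v)))
  have C := hasDerivAt_affine (spaceForm x v) (spaceForm v v)
  have H := ((((((A 1 1).add (A 1 (-1))).add (A (-1) 1)).add (A (-1) (-1))).const_mul 4).add
    (((X.mul_const (v 0)).const_mul 2).mul B)).add (((X.pow 2).const_mul 2).mul C) |>.sub
    (((X.pow 3).mul_const (v 0)).const_mul (2187 / 16))
  refine (H.congr_deriv ?_).congr_of_eventuallyEq (Filter.Eventually.of_forall fun t => ?_)
  · simp only [quarticHess, Pi.add_apply, Pi.mul_apply, Pi.pow_apply, id, spaceForm_comm v x]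
    push_cast
    ring
  · simp only [Pi.add_apply, Pi.mul_apply, Pi.sub_apply, Pi.pow_apply, id]

/-! ### Homogeneity and convexity of the quartic -/

theorem quarticDeriv_self (x : Mink) : quarticDeriv x x = 4 * quartic x := by
  rw [quarticDeriv, quartic]; ring

theorem quarticDeriv_add_right (x y z : Mink) :
    quarticDeriv x (y + z) = quarticDeriv x y + quarticDeriv x z := by
  simp only [quarticDeriv, facet_add, spaceForm_add_right, Pi.add_apply]; ring

theorem quarticDeriv_smul_right (a : ℝ) (x y : Mink) :
    quarticDeriv x (a • y) = a * quarticDeriv x y := by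
  simp only [quarticDeriv, facet_smul, spaceForm_smul_right, Pi.smul_apply, smul_eq_mul]; ring

theorem quarticDeriv_smul_left (a : ℝ) (x y : Mink) :
    quarticDeriv (a • x) y = a ^ 3 * quarticDeriv x y := by
  simp only [quarticDeriv, facet_smul, spaceForm_smul_left, spaceForm_smul_right, Pi.smul_apply,
    smul_eq_mul]; ring

theorem quartic_smul (a : ℝ) (x : Mink) : quartic (a • x) = a ^ 4 * quartic x := by
  simp only [quartic, facet_smul, spaceForm_smul_left, spaceForm_smul_right, Pi.smul_apply,
    smul_eq_mul]; ring

theorem tangent_line_pow_four (a b : ℝ) : 0 ≤ b ^ 4 - 4 * a ^ 3 * b + 3 * a ^ 4 := by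
  have : b ^ 4 - 4 * a ^ 3 * b + 3 * a ^ 4 = (b - a) ^ 2 * ((b + a) ^ 2 + 2 * a ^ 2) := by ring
  rw [this]; positivity

/-- In an affine chart the quartic is a strictly convex function. -/
theorem quartic_gradient_inequality {x y : Mink} (h : y 0 = x 0) :
    x 0 ^ 2 * spaceForm (y - x) (y - x) ≤ quartic y - quarticDeriv x y + 3 * quartic x := by
  have e : spaceForm (y - x) (y - x) = spaceForm y y - 2 * spaceForm x y + spaceForm x x := by
    simp only [spaceForm, Pi.sub_apply]; ring
  have h1 := tangent_line_pow_four (facet 1 1 x) (facet 1 1 y)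
  have h2 := tangent_line_pow_four (facet 1 (-1) x) (facet 1 (-1) y)
  have h3 := tangent_line_pow_four (facet (-1) 1 x) (facet (-1) 1 y)
  have h4 := tangent_line_pow_four (facet (-1) (-1) x) (facet (-1) (-1) y)
  rw [e, quartic, quartic, quarticDeriv, h]
  linarith

/-- By homogeneity both points may be rescaled to the common height x₀y₀, where the gradient
inequality is strict. -/
theorem quarticDeriv_neg {x y : Mink} (hx : x ∈ H3) (hy : y ∈ H3) (hGx : quartic x = 0)
    (hGy : quartic y = 0) (hne : y ≠ x) : quarticDeriv x y < 0 := by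
  have hx0 := hx.2
  have hy0 := hy.2
  have h := quartic_gradient_inequality (x := y 0 • x) (y := x 0 • y) (by simp [mul_comm])
  rw [quartic_smul, quartic_smul, hGx, hGy, quarticDeriv_smul_left, quarticDeriv_smul_right] at h
  have hd : x 0 • y - y 0 • x ≠ 0 := by
    intro h0
    have h1 : x 0 • y = y 0 • x := sub_eq_zero.1 h0
    have h2 : x 0 ^ 2 = y 0 ^ 2 := by
      have := congrArg (fun z => lor z z) h1
      simp only [lor_smul_left, lor_smul_right, hx.1, hy.1] at this
      linarith
    have h3 : x 0 = y 0 := by nlinarith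
    rw [h3] at h1
    exact hne (smul_right_injective _ hy0.ne' h1)
  have hp := spaceForm_self_pos (x := x 0 • y - y 0 • x) (by simp [mul_comm]) hd
  have h2 : 0 < (y 0 • x) 0 ^ 2 * spaceForm (x 0 • y - y 0 • x) (x 0 • y - y 0 • x) := by
    refine mul_pos (pow_pos ?_ 2) hp
    simpa using mul_pos hy0 hx0
  by_contra hcon
  have : 0 ≤ y 0 ^ 3 * (x 0 * quarticDeriv x y) :=
    mul_nonneg (by positivity) (mul_nonneg hx0.le (not_lt.1 hcon))
  linarith

theorem quarticHess_pos {p v : Mink} (hp : p ∈ H3) (hG : quartic p = 0) (hv : v ≠ 0)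
    (hpv : lor p v = 0) (hD : quarticDeriv p v = 0) : 0 < quarticHess p v := by
  have hp0 := hp.2
  -- Sliding v along the ray of p to height zero puts it in the chart. By Euler's relations the
  -- correction terms are multiples of dG(v) and G, both zero here.
  set w : Mink := p 0 • v + (-v 0) • p with hw
  have hw0 : w 0 = 0 := by simp [hw]; ring
  have hne : w ≠ 0 := by
    intro h
    have := congrArg (lor p) h
    rw [hw, lor_add_right, lor_smul_right, lor_smul_right, hpv, hp.1, lor_zero_right] at this
    have hv0 : v 0 = 0 := by linarith
    rw [hw, hv0] at h
    simp only [neg_zero, zero_smul, add_zero] at h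
    exact (smul_ne_zero hp0.ne' hv) h
  have key : quarticHess p w = p 0 ^ 2 * quarticHess p v := by
    have e : quarticHess p w = p 0 ^ 2 * quarticHess p v - 6 * p 0 * v 0 * quarticDeriv p v
        + 12 * v 0 ^ 2 * quartic p := by
      simp only [quarticHess, quarticDeriv, quartic, hw, facet_add, facet_smul,
        spaceForm_add_left, spaceForm_add_right, spaceForm_smul_left, spaceForm_smul_right,
        Pi.add_apply, Pi.smul_apply, smul_eq_mul, spaceForm_comm v p]
      ring
    rw [e, hD, hG]; ring
  have hpos : 0 < quarticHess p w := by
    rw [quarticHess, hw0]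
    have := mul_pos (pow_pos hp0 2) (spaceForm_self_pos hw0 hne)
    have h2 : 0 ≤ facet 1 1 p ^ 2 * facet 1 1 w ^ 2 + facet 1 (-1) p ^ 2 * facet 1 (-1) w ^ 2
      + facet (-1) 1 p ^ 2 * facet (-1) 1 w ^ 2 + facet (-1) (-1) p ^ 2 * facet (-1) (-1) w ^ 2 := by
      positivity
    linarith
  rw [key] at hpos
  exact pos_of_mul_pos_right hpos (by positivity)

/-! ### Boundedness and compactness -/

theorem pow_four_ge (a b : ℝ) : 4 * b ^ 2 * a ^ 2 - 4 * b ^ 4 ≤ a ^ 4 := by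
  nlinarith [sq_nonneg (a ^ 2 - 2 * b ^ 2)]

/-- Bounding each fourth power below by a quadratic leaves an ellipsoid after division by x₀². As 35
< 54, it lies strictly inside the light cone. -/
theorem quartic_bound {x : Mink} (h0 : 0 < x 0) (h : quartic x ≤ 0) :
    54 * (x 1 ^ 2 + x 2 ^ 2 + x 3 ^ 2) ≤ 35 * x 0 ^ 2 := by
  have h1 := pow_four_ge (facet 1 1 x) (x 0)
  have h2 := pow_four_ge (facet 1 (-1) x) (x 0)
  have h3 := pow_four_ge (facet (-1) 1 x) (x 0)
  have h4 := pow_four_ge (facet (-1) (-1) x) (x 0)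
  have e : facet 1 1 x ^ 2 + facet 1 (-1) x ^ 2 + facet (-1) 1 x ^ 2 + facet (-1) (-1) x ^ 2 =
      4 * x 0 ^ 2 + 16 * x 1 ^ 2 + 3600 / 121 * x 2 ^ 2 + 25 / 4 * x 3 ^ 2 := by
    simp only [facet]; ring
  have h5 : x 0 ^ 2 * (4 * (4 * x 0 ^ 2 + 16 * x 1 ^ 2 + 3600 / 121 * x 2 ^ 2 + 25 / 4 * x 3 ^ 2)
      - 16 * x 0 ^ 2 + spaceForm x x - 2187 / 64 * x 0 ^ 2) ≤ 0 := by
    rw [← e]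
    rw [quartic] at h
    linarith
  have h6 := nonpos_of_mul_nonpos_right h5 (pow_pos h0 2)
  rw [spaceForm] at h6
  nlinarith [sq_nonneg (x 1), sq_nonneg (x 2), sq_nonneg (x 3), sq_nonneg (x 0)]

theorem isCompact_quartic : IsCompact {x | x ∈ H3 ∧ quartic x = 0} := by
  have hlor : Continuous fun x : Mink => lor x x := by unfold lor; fun_prop
  have hset : {x | x ∈ H3 ∧ quartic x = 0} =
      {x : Mink | lor x x = -1} ∩ {x | 0 ≤ x 0} ∩ {x | quartic x = 0} := by
    ext x
    simp only [H3, Set.mem_ofPred_eq, Set.mem_inter_iff]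
    refine and_congr_left fun _ => and_congr_right fun h => ⟨le_of_lt, fun h0 => ?_⟩
    refine lt_of_le_of_ne h0 fun h1 => ?_
    rw [lor, ← h1] at h
    nlinarith [sq_nonneg (x 1), sq_nonneg (x 2), sq_nonneg (x 3)]
  refine Metric.isCompact_of_isClosed_isBounded ?_ ?_
  · rw [hset]
    exact ((isClosed_eq hlor continuous_const).inter
      (isClosed_le continuous_const (continuous_apply 0))).inter
      (isClosed_eq contDiff_quartic.continuous continuous_const)
  · refine (Metric.isBounded_closedBall (x := (0 : Mink)) (r := 2)).subset ?_
    rintro x ⟨⟨h1, h0⟩, hG⟩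
    have hb := quartic_bound h0 hG.le
    rw [lor] at h1
    rw [mem_closedBall_zero_iff, pi_norm_le_iff_of_nonneg (by norm_num)]
    intro i
    rw [Real.norm_eq_abs]
    refine abs_le_of_sq_le_sq ?_ (by norm_num)
    have k1 := sq_nonneg (x 1)
    have k2 := sq_nonneg (x 2)
    have k3 := sq_nonneg (x 3)
    fin_cases i
    · change x 0 ^ 2 ≤ 2 ^ 2; linarith
    · change x 1 ^ 2 ≤ 2 ^ 2; linarith
    · change x 2 ^ 2 ≤ 2 ^ 2; linarith
    · change x 3 ^ 2 ≤ 2 ^ 2; linarith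

/-! ### The affine chart -/

/-- The point of the hyperplane `x₀ = 1` with given space coordinates. -/
def chart (y : Fin 3 → ℝ) : Mink := ![1, y 0, y 1, y 2]

theorem continuous_chart : Continuous chart := by
  refine continuous_pi fun i => ?_
  fin_cases i
  · exact continuous_const
  · exact continuous_apply 0
  · exact continuous_apply 1
  · exact continuous_apply 2

theorem chart_combo {a b : ℝ} (hab : a + b = 1) (x y : Fin 3 → ℝ) :
    chart (a • x + b • y) = a • chart x + b • chart y := by
  ext i; fin_cases i <;> simp [chart, hab]

theorem convexOn_quartic_chart : ConvexOn ℝ Set.univ fun y => quartic (chart y) := by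
  refine ⟨convex_univ, fun x _ y _ a b ha hb hab => ?_⟩
  set z := a • x + b • y with hz
  have hx := (mul_nonneg (sq_nonneg _) (spaceForm_self_nonneg _)).trans
    (quartic_gradient_inequality (x := chart z) (y := chart x) rfl)
  have hy := (mul_nonneg (sq_nonneg _) (spaceForm_self_nonneg _)).trans
    (quartic_gradient_inequality (x := chart z) (y := chart y) rfl)
  have h : a * quarticDeriv (chart z) (chart x) + b * quarticDeriv (chart z) (chart y) =
      4 * quartic (chart z) := by
    rw [← quarticDeriv_smul_right, ← quarticDeriv_smul_right, ← quarticDeriv_add_right,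
      ← chart_combo hab, ← hz, quarticDeriv_self]
  simp only [smul_eq_mul]
  have e : quartic (chart z) = (a + b) * quartic (chart z) := by rw [hab, one_mul]
  nlinarith [mul_nonneg ha hx, mul_nonneg hb hy]

/-- The convex body bounded by the quartic in the affine chart. -/
def body : Set (Fin 3 → ℝ) := {y | quartic (chart y) ≤ 0}

theorem continuous_quartic_chart : Continuous fun y => quartic (chart y) :=
  contDiff_quartic.continuous.comp continuous_chart

theorem quartic_chart_zero : quartic (chart 0) < 0 := by
  simp [quartic, chart, facet, spaceForm]; norm_num

theorem subset_interior_body : {y | quartic (chart y) < 0} ⊆ interior body :=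
  interior_maximal (fun y hy => show quartic (chart y) ≤ 0 from le_of_lt hy)
    (isOpen_lt continuous_quartic_chart continuous_const)

theorem frontier_body : frontier body = {y | quartic (chart y) = 0} := by
  have hcl : IsClosed body := isClosed_le continuous_quartic_chart continuous_const
  rw [hcl.frontier_eq]
  ext y
  constructor
  · rintro ⟨h1, h2⟩
    exact le_antisymm h1 (not_lt.1 fun h => h2 (subset_interior_body h))
  · intro h
    have h : quartic (chart y) = 0 := h
    refine ⟨h.le, fun hi => ?_⟩
    have hc : Filter.Tendsto (fun t : ℝ => t • y) (nhds 1) (nhds y) := by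
      have : Continuous fun t : ℝ => t • y := by fun_prop
      simpa using this.tendsto 1
    have hev := (hc.eventually (isOpen_interior.mem_nhds hi)).filter_mono
      (nhdsWithin_le_nhds (s := Set.Ioi 1))
    obtain ⟨t, ht, ht1⟩ := (hev.and self_mem_nhdsWithin).exists
    have ht1 : 1 < t := ht1
    have ht2 : t • y ∈ body := interior_subset ht
    have ht2 : quartic (chart (t • y)) ≤ 0 := ht2
    have hinv : t⁻¹ < 1 := inv_lt_one_of_one_lt₀ ht1
    have hpos : 0 ≤ t⁻¹ := by positivity
    have hsub : 0 ≤ 1 - t⁻¹ := by linarith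
    -- An interior zero y could be pushed outward to t • y in the body; then y lies between that
    -- point and the origin, where the quartic is negative, so its value would be negative.
    have h3 := convexOn_quartic_chart.2 (Set.mem_univ (t • y)) (Set.mem_univ 0) hpos hsub
      (by ring)
    simp only [smul_zero, add_zero, smul_eq_mul] at h3
    rw [inv_smul_smul₀ (by positivity), h] at h3
    nlinarith [mul_nonneg (show 0 ≤ t⁻¹ by positivity) (neg_nonneg.2 ht2),
      mul_pos (sub_pos.2 hinv) (neg_pos.2 quartic_chart_zero)]

theorem body_bound {y : Fin 3 → ℝ} (hy : y ∈ body) :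
    54 * (y 0 ^ 2 + y 1 ^ 2 + y 2 ^ 2) ≤ 35 := by
  have := quartic_bound (x := chart y) (by simp [chart]) hy
  simpa [chart] using this

/-- A bounded convex set with interior has its frontier carried to the unit sphere by a
homeomorphism of the whole space. -/
theorem isConnected_frontier_body : IsConnected (frontier body) := by
  have hconv : Convex ℝ body := by
    have := convexOn_quartic_chart.convex_le 0
    simpa [body] using this
  have hint : (interior body).Nonempty :=
    ⟨0, subset_interior_body quartic_chart_zero⟩
  have hbdd : Bornology.IsBounded body := by
    refine (Metric.isBounded_closedBall (x := (0 : Fin 3 → ℝ)) (r := 1)).subset fun y hy => ?_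
    have := body_bound hy
    rw [mem_closedBall_zero_iff, pi_norm_le_iff_of_nonneg (by norm_num)]
    intro i
    rw [Real.norm_eq_abs]
    refine abs_le_of_sq_le_sq ?_ (by norm_num)
    have k0 := sq_nonneg (y 0)
    have k1 := sq_nonneg (y 1)
    have k2 := sq_nonneg (y 2)
    fin_cases i
    · change y 0 ^ 2 ≤ 1 ^ 2; linarith
    · change y 1 ^ 2 ≤ 1 ^ 2; linarith
    · change y 2 ^ 2 ≤ 1 ^ 2; linarith
  obtain ⟨h, -, -, hf⟩ := exists_homeomorph_image_interior_closure_frontier_eq_unitBall hconv hint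
    hbdd
  have hs : IsConnected (Metric.sphere (0 : Fin 3 → ℝ) 1) :=
    isConnected_sphere (by simp) 0 zero_le_one
  rw [← hf] at hs
  have := hs.image h.symm h.symm.continuous.continuousOn
  rwa [Set.image_image, show (fun x => h.symm (h x)) = id by ext; simp, Set.image_id] at this

/-- The projection of a timelike vector to the hyperboloid. -/
def unitize (x : Mink) : Mink := (√(-lor x x))⁻¹ • x

/-- Central projection carries the frontier of the body in the chart onto the surface; it is
continuous there because the frontier lies in the open unit ball. -/
theorem isConnected_quartic : IsConnected {x | x ∈ H3 ∧ quartic x = 0} := by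
  have himg : {x | x ∈ H3 ∧ quartic x = 0} = (fun y => unitize (chart y)) '' frontier body := by
    rw [frontier_body]
    ext x
    constructor
    · rintro ⟨⟨h1, h0⟩, hG⟩
      have hx : chart ![x 1 / x 0, x 2 / x 0, x 3 / x 0] = (x 0)⁻¹ • x := by
        ext i; fin_cases i <;> simp [chart, h0.ne', div_eq_inv_mul]
      refine ⟨![x 1 / x 0, x 2 / x 0, x 3 / x 0], ?_, ?_⟩
      · rw [Set.mem_ofPred_eq, hx, quartic_smul, hG, mul_zero]
      · simp only
        rw [hx, unitize, lor_smul_left, lor_smul_right, h1,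
          show -((x 0)⁻¹ * ((x 0)⁻¹ * -1)) = (x 0)⁻¹ ^ 2 by ring,
          Real.sqrt_sq (by positivity), inv_inv, smul_inv_smul₀ h0.ne']
    · rintro ⟨y, hy, rfl⟩
      have hy : quartic (chart y) = 0 := hy
      have hb := body_bound (y := y) hy.le
      have hl : 0 < -lor (chart y) (chart y) := by
        simp only [lor, chart]; simp; nlinarith
      have hs := Real.sqrt_pos.2 hl
      refine ⟨⟨?_, ?_⟩, ?_⟩
      · simp only [unitize]
        rw [lor_smul_left, lor_smul_right, ← mul_assoc, ← mul_inv, Real.mul_self_sqrt hl.le, inv_neg,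
          neg_mul, inv_mul_cancel₀ (neg_pos.1 hl).ne]
      · simpa [unitize, chart] using hs
      · simp only [unitize]
        rw [quartic_smul, hy, mul_zero]
  rw [himg]
  refine isConnected_frontier_body.image _ ?_
  have hlor : Continuous fun y => -lor (chart y) (chart y) := by
    have := continuous_chart
    unfold lor; fun_prop
  refine ContinuousOn.smul (ContinuousOn.inv₀ hlor.sqrt.continuousOn fun y hy => ?_)
    continuous_chart.continuousOn
  rw [frontier_body] at hy
  have hb := body_bound (y := y) (le_of_eq hy)
  refine (Real.sqrt_pos.2 ?_).ne'
  simp only [lor, chart]; simp; nlinarith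

theorem convexEquation_quartic : ConvexEquation quartic where
  smooth := contDiff_quartic
  compact := isCompact_quartic
  connected := isConnected_quartic
  radial p _ h := by rw [fderiv_quartic, quarticDeriv_self, h, mul_zero]
  regular p hp h h0 := by
    -- If the derivative vanished, the gradient inequality would make the quartic nonnegative at the
    -- centre.
    have h1 : quarticDeriv p (p 0 • chart 0) = 0 := by rw [← fderiv_quartic, h0]; rfl
    have h2 := (mul_nonneg (sq_nonneg _) (spaceForm_self_nonneg _)).trans
      (quartic_gradient_inequality (x := p) (y := p 0 • chart 0) (by simp [chart]))
    rw [h1, h, quartic_smul] at h2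
    have := mul_pos (pow_pos hp.2 4) (neg_pos.2 quartic_chart_zero)
    linarith
  support p hp h x hx hx0 hne := by
    rw [fderiv_quartic]; exact quarticDeriv_neg hp hx h hx0 hne
  hessian p hp h v hv hpv hD := by
    rw [fderiv_quartic] at hD
    simp only [fderiv_quartic]
    rw [fderiv_quarticDeriv]
    exact quarticHess_pos hp h hv hpv hD

/-! ### A periodic orbit -/

/-- The surface with equation `quartic = 0`. -/
def quarticSurface : CompactSurface := convexEquation_quartic.surface

theorem supported_quarticSurface : quarticSurface.Supported := convexEquation_quartic.supported

/-- The factor that normalizes the vectors spanning the lines of the orbit. -/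
def lineScale : ℝ := (√9520)⁻¹

/-- The factor that normalizes the points of tangency. -/
def tangencyScale : ℝ := (√1190)⁻¹

theorem lineScale_pos : 0 < lineScale := by unfold lineScale; positivity

theorem tangencyScale_pos : 0 < tangencyScale := by unfold tangencyScale; positivity

theorem lineScale_sq : lineScale * lineScale = 1 / 9520 := by
  rw [lineScale, ← mul_inv, Real.mul_self_sqrt (by norm_num), one_div]

theorem tangencyScale_sq : tangencyScale * tangencyScale = 1 / 1190 := by
  rw [tangencyScale, ← mul_inv, Real.mul_self_sqrt (by norm_num), one_div]

/-- Base point of an even line of the orbit, up to scale. The parameter is a sign, which is switched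
by the rotation by `π` about the third coordinate axis. -/
def baseEven (s : ℝ) : Mink := ![135, 90 * s, -(22 / 5) * s, 121 / 5]

/-- Direction of an even line. -/
def velEven (s : ℝ) : Mink := ![33, 22 * s, -18 * s, 99]

/-- Base point of an odd line. -/
def baseOdd (s : ℝ) : Mink := ![121, 6 * s, 66 * s, -27]

/-- Direction of an odd line. -/
def velOdd (s : ℝ) : Mink := ![-33, -22 * s, -18 * s, 99]

/-- Left point of tangency of an even line. -/
def touchEven (s : ℝ) : Mink := ![40, 15 * s, -11 * s, 8]

/-- Left point of tangency of an odd line. -/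
def touchOdd (s : ℝ) : Mink := ![40, 15 * s, 11 * s, -8]

@[simp] theorem vec_two (a b c d : ℝ) : (![a, b, c, d] : Mink) 2 = c := rfl

@[simp] theorem vec_three (a b c d : ℝ) : (![a, b, c, d] : Mink) 3 = d := rfl

theorem unitTangent_smul {Q E : Mink} (h0 : 0 < Q 0) (hQ : lor Q Q = -9520) (hQE : lor Q E = 0)
    (hE : lor E E = 9520) : UnitTangent (lineScale • Q) (lineScale • E) := by
  refine ⟨⟨?_, ?_⟩, ?_, ?_⟩
  · rw [lor_smul_left, lor_smul_right, hQ, ← mul_assoc, lineScale_sq]; norm_num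
  · exact mul_pos lineScale_pos h0
  · rw [lor_smul_left, lor_smul_right, hQE]; ring
  · rw [lor_smul_left, lor_smul_right, hE, ← mul_assoc, lineScale_sq]; norm_num

theorem mem_quarticSurface {P : Mink} (h0 : 0 < P 0) (hP : lor P P = -1190)
    (hG : quartic P = 0) : tangencyScale • P ∈ quarticSurface.carrier := by
  refine ⟨⟨?_, ?_⟩, ?_⟩
  · rw [lor_smul_left, lor_smul_right, hP, ← mul_assoc, tangencyScale_sq]; norm_num
  · exact mul_pos tangencyScale_pos h0
  · rw [quartic_smul, hG, mul_zero]

theorem lor_normal_smul_eq_zero {P X : Mink} (hP : tangencyScale • P ∈ quarticSurface.carrier)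
    (h : quarticDeriv P X = 0) :
    lor (quarticSurface.normal (tangencyScale • P)) (lineScale • X) = 0 := by
  refine (convexEquation_quartic.lor_normal_eq_zero_iff hP _).2 ?_
  rw [fderiv_quartic, quarticDeriv_smul_left, quarticDeriv_smul_right, h]; ring

theorem hyp_smul (r : ℝ) (Q E : Mink) (d : ℝ) :
    hyp (r • Q) (r • E) d = r • (Real.cosh d • Q + Real.sinh d • E) := by
  rw [hyp]; module

theorem hypVel_smul (r : ℝ) (Q E : Mink) (d : ℝ) :
    hypVel (r • Q) (r • E) d = r • (Real.sinh d • Q + Real.cosh d • E) := by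
  rw [hypVel]; module

theorem posFrame_smul {r ρ : ℝ} (hr : 0 < r) (hρ : 0 < ρ) {Q A B E : Mink}
    (h : PosFrame Q A B E) : PosFrame (r • Q) (ρ • A) (ρ • B) (r • E) := by
  rw [PosFrame] at *
  have e : (Matrix.of ![r • Q, ρ • A, ρ • B, r • E]).det =
      r ^ 2 * ρ ^ 2 * (Matrix.of ![Q, A, B, E]).det := by
    simp only [frame_det, Pi.smul_apply, smul_eq_mul]; ring
  rw [e]; positivity

/-- The signed distance along the even lines of the orbit. -/
def distEven : ℝ := -Real.arsinh (495 / 952)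

/-- The signed distance along the odd lines of the orbit. -/
def distOdd : ℝ := Real.arsinh (33 / 56)

theorem sinh_distEven : Real.sinh distEven = -(495 / 952) := by
  rw [distEven, Real.sinh_neg, Real.sinh_arsinh]

theorem cosh_distEven : Real.cosh distEven = 1073 / 952 := by
  rw [distEven, Real.cosh_neg, Real.cosh_arsinh,
    show (1 : ℝ) + (495 / 952) ^ 2 = (1073 / 952) ^ 2 by norm_num, Real.sqrt_sq (by norm_num)]

theorem sinh_distOdd : Real.sinh distOdd = 33 / 56 := by
  rw [distOdd, Real.sinh_arsinh]

theorem cosh_distOdd : Real.cosh distOdd = 65 / 56 := by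
  rw [distOdd, Real.cosh_arsinh,
    show (1 : ℝ) + (33 / 56) ^ 2 = (65 / 56) ^ 2 by norm_num, Real.sqrt_sq (by norm_num)]

/-- The foot for the right tangency point is the image of the base point under the half-turn about
the first axis, which reverses the line. -/
theorem hyp_even (s : ℝ) : hyp (lineScale • baseEven s) (lineScale • velEven s) distEven =
    lineScale • ![135, 90 * s, 22 / 5 * s, -(121 / 5)] := by
  rw [hyp_smul, sinh_distEven, cosh_distEven]
  congr 1
  ext i; fin_cases i <;> simp [baseEven, velEven] <;> ring

theorem hypVel_even (s : ℝ) : hypVel (lineScale • baseEven s) (lineScale • velEven s) distEven =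
    lineScale • velOdd s := by
  rw [hypVel_smul, sinh_distEven, cosh_distEven]
  congr 1
  ext i; fin_cases i <;> simp [baseEven, velEven, velOdd] <;> ring

/-- Here the half-turn about the second axis plays this role. -/
theorem hyp_odd (s : ℝ) : hyp (lineScale • baseOdd s) (lineScale • velOdd s) distOdd =
    lineScale • ![121, -6 * s, 66 * s, 27] := by
  rw [hyp_smul, sinh_distOdd, cosh_distOdd]
  congr 1
  ext i; fin_cases i <;> simp [baseOdd, velOdd] <;> ring

theorem hypVel_odd (s : ℝ) : hypVel (lineScale • baseOdd s) (lineScale • velOdd s) distOdd =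
    lineScale • velEven (-s) := by
  rw [hypVel_smul, sinh_distOdd, cosh_distOdd]
  congr 1
  ext i; fin_cases i <;> simp [baseOdd, velOdd, velEven] <;> ring

/-- The coefficients of `quartic` are fitted to this point: for s = 1 it is a zero, with tangent
plane 6x₀ = 9x₁ - 11x₂ - 2x₃. The other three tangency points and planes follow by half-turns. -/
theorem touchEven_mem {s : ℝ} (hs : s = 1 ∨ s = -1) :
    tangencyScale • touchEven s ∈ quarticSurface.carrier := by
  apply mem_quarticSurface <;> rcases hs with rfl | rfl <;>
    norm_num [touchEven, lor, quartic, facet, spaceForm]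

theorem touchOdd_mem {s : ℝ} (hs : s = 1 ∨ s = -1) :
    tangencyScale • touchOdd s ∈ quarticSurface.carrier := by
  apply mem_quarticSurface <;> rcases hs with rfl | rfl <;>
    norm_num [touchOdd, lor, quartic, facet, spaceForm]

theorem stepEven {s : ℝ} (hs : s = 1 ∨ s = -1) :
    Step quarticSurface (lineScale • baseEven s) (lineScale • velEven s) distEven
      (tangencyScale • touchOdd s) (tangencyScale • touchEven s) where
  tan := by
    apply unitTangent_smul <;> rcases hs with rfl | rfl <;> norm_num [baseEven, velEven, lor]
  memA := touchOdd_mem hs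
  memB := touchEven_mem hs
  normalA := by
    constructor <;> apply lor_normal_smul_eq_zero (touchOdd_mem hs) <;> rcases hs with rfl | rfl <;>
      norm_num [touchOdd, baseEven, velEven, quarticDeriv, facet, spaceForm]
  normalB := by
    constructor <;> apply lor_normal_smul_eq_zero (touchEven_mem hs) <;>
      rcases hs with rfl | rfl <;>
      norm_num [touchEven, baseEven, velEven, quarticDeriv, facet, spaceForm]
  footA := by
    rw [hypVel_even, lor_smul_left, lor_smul_right]
    rcases hs with rfl | rfl <;> norm_num [touchOdd, velOdd, lor]
  footB := by
    rw [lor_smul_left, lor_smul_right]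
    rcases hs with rfl | rfl <;> norm_num [touchEven, velEven, lor]
  frame := by
    refine posFrame_smul lineScale_pos tangencyScale_pos ?_
    rw [PosFrame, frame_det]
    rcases hs with rfl | rfl <;> norm_num [touchOdd, touchEven, baseEven, velEven]

theorem stepOdd {s s' : ℝ} (hs : s = 1 ∧ s' = -1 ∨ s = -1 ∧ s' = 1) :
    Step quarticSurface (lineScale • baseOdd s) (lineScale • velOdd s) distOdd
      (tangencyScale • touchEven s') (tangencyScale • touchOdd s) := by
  have h1 : s = 1 ∨ s = -1 := hs.imp And.left And.left
  have h2 : s' = 1 ∨ s' = -1 := (hs.imp And.right And.right).symm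
  refine ⟨?_, touchEven_mem h2, touchOdd_mem h1, ?_, ?_, ?_, ?_, ?_⟩
  · apply unitTangent_smul <;> rcases h1 with rfl | rfl <;> norm_num [baseOdd, velOdd, lor]
  · constructor <;> apply lor_normal_smul_eq_zero (touchEven_mem h2) <;>
      rcases hs with ⟨rfl, rfl⟩ | ⟨rfl, rfl⟩ <;>
      norm_num [touchEven, baseOdd, velOdd, quarticDeriv, facet, spaceForm]
  · constructor <;> apply lor_normal_smul_eq_zero (touchOdd_mem h1) <;> rcases h1 with rfl | rfl <;>
      norm_num [touchOdd, baseOdd, velOdd, quarticDeriv, facet, spaceForm]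
  · rw [hypVel_odd, lor_smul_left, lor_smul_right]
    rcases hs with ⟨rfl, rfl⟩ | ⟨rfl, rfl⟩ <;> norm_num [touchEven, velEven, lor]
  · rw [lor_smul_left, lor_smul_right]
    rcases h1 with rfl | rfl <;> norm_num [touchOdd, velOdd, lor]
  · refine posFrame_smul lineScale_pos tangencyScale_pos ?_
    rw [PosFrame, frame_det]
    rcases hs with ⟨rfl, rfl⟩ | ⟨rfl, rfl⟩ <;> norm_num [touchOdd, touchEven, baseOdd, velOdd]

/-- The point reflection at a normalized point of tangency. -/
theorem reflect_smul {X P : Mink} :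
    -(lineScale • X) - (2 * lor (lineScale • X) (tangencyScale • P)) • (tangencyScale • P) =
      lineScale • (-X - (lor X P / 595) • P) := by
  have h : (2 * lor (lineScale • X) (tangencyScale • P)) • (tangencyScale • P) =
      lineScale • ((lor X P / 595) • P) := by
    rw [lor_smul_left, lor_smul_right, smul_smul, smul_smul]
    congr 1
    linear_combination 2 * lineScale * lor X P * tangencyScale_sq
  rw [h]; module

theorem outerBilliard_even {s s' : ℝ} (hs : s = 1 ∧ s' = -1 ∨ s = -1 ∧ s' = 1)
    (h1 : s = 1 ∨ s = -1) :
    outerBilliard quarticSurface ((stepEven h1).table supported_quarticSurface) =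
      (stepOdd hs).table supported_quarticSurface := by
  refine (stepEven h1).outerBilliard_eq supported_quarticSurface (stepOdd hs)
    (hypVel_even s).symm ?_
  rw [hyp_even, reflect_smul]
  congr 1
  rcases h1 with rfl | rfl <;> ext i <;> fin_cases i <;> norm_num [baseOdd, touchOdd, lor]

theorem outerBilliard_odd {s s' : ℝ} (hs : s = 1 ∧ s' = -1 ∨ s = -1 ∧ s' = 1)
    (h2 : s' = 1 ∨ s' = -1) :
    outerBilliard quarticSurface ((stepOdd hs).table supported_quarticSurface) =
      (stepEven h2).table supported_quarticSurface := by
  have hn : s' = -s := by rcases hs with ⟨rfl, rfl⟩ | ⟨rfl, rfl⟩ <;> norm_num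
  refine (stepOdd hs).outerBilliard_eq supported_quarticSurface (stepEven h2)
    (by rw [hypVel_odd, hn]) ?_
  rw [hyp_odd, reflect_smul]
  congr 1
  rcases hs with ⟨rfl, rfl⟩ | ⟨rfl, rfl⟩ <;> ext i <;> fin_cases i <;>
    norm_num [baseEven, touchEven, lor]

/-- On the even line of sign s every point has x₁ = (2/3) s x₀, so the two lines are disjoint. -/
theorem stepEven_table_ne (h₁ : (1 : ℝ) = 1 ∨ (1 : ℝ) = -1) (h₂ : (-1 : ℝ) = 1 ∨ (-1 : ℝ) = -1) :
    (stepEven h₂).table supported_quarticSurface ≠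
      (stepEven h₁).table supported_quarticSurface := by
  intro h
  have hp := congrArg (fun ℓ : quarticSurface.Table => ℓ.1.points) h
  simp only [Step.table, UnitTangent.line_points] at hp
  have hmem : hyp (lineScale • baseEven (-1)) (lineScale • velEven (-1)) 0 ∈
      Set.range (hyp (lineScale • baseEven 1) (lineScale • velEven 1)) := hp ▸ ⟨0, rfl⟩
  obtain ⟨t, ht⟩ := hmem
  have e0 := congrFun ht 0
  have e1 := congrFun ht 1
  have hr := lineScale_pos
  rw [hyp_zero, hyp_smul] at e0 e1
  simp only [baseEven, velEven, Pi.smul_apply, Pi.add_apply, smul_eq_mul, Matrix.cons_val_zero,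
    Matrix.cons_val_one] at e0 e1
  linarith

end OuterBilliard

end

open OuterBilliard in
theorem mainTheorem7 :
    ∃ S : OuterBilliard.CompactSurface, S.QuadraticallyConvex ∧
      ∃ ℓ : S.Table,
        Function.minimalPeriod (OuterBilliard.outerBilliard S) ℓ = 4 ∧
        ∃ h : ℝ, OuterBilliard.IsHolonomy S ℓ h ∧ h ≠ 0 := by
  have p : (1 : ℝ) = 1 ∨ (1 : ℝ) = -1 := Or.inl rfl
  have n : (-1 : ℝ) = 1 ∨ (-1 : ℝ) = -1 := Or.inr rfl
  have pn : (1 : ℝ) = 1 ∧ (-1 : ℝ) = -1 ∨ (1 : ℝ) = -1 ∧ (-1 : ℝ) = 1 := Or.inl ⟨rfl, rfl⟩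
  have np : (-1 : ℝ) = 1 ∧ (1 : ℝ) = -1 ∨ (-1 : ℝ) = -1 ∧ (1 : ℝ) = 1 := Or.inr ⟨rfl, rfl⟩
  have hS := supported_quarticSurface
  have b0 := outerBilliard_even pn p
  have b1 := outerBilliard_odd pn n
  have b2 := outerBilliard_even np n
  have b3 := outerBilliard_odd np p
  have hper : Function.IsPeriodicPt (outerBilliard quarticSurface) 4 ((stepEven p).table hS) := by
    rw [Function.IsPeriodicPt, Function.IsFixedPt]
    simp only [Function.iterate_succ, Function.iterate_zero, Function.comp_apply, id, b0, b1, b2,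
      b3]
  have hmin : Function.minimalPeriod (outerBilliard quarticSurface) ((stepEven p).table hS) = 4 := by
    -- Since 4 = 2², it suffices to exclude period 2, which would identify the two even lines.
    refine Function.minimalPeriod_eq_prime_pow (p := 2) (k := 1) (fun h => ?_) hper
    rw [Function.IsPeriodicPt, Function.IsFixedPt] at h
    simp only [pow_one, Function.iterate_succ, Function.iterate_zero, Function.comp_apply, id, b0,
      b1] at h
    exact stepEven_table_ne p n h
  refine ⟨quarticSurface, convexEquation_quartic.quadraticallyConvex, (stepEven p).table hS, hmin,
    ∑ k ∈ Finset.range 4, if Even k then distEven else distOdd,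
    ⟨⟨4, by norm_num, hper⟩, fun k => if Even k then distEven else distOdd, ?_, by rw [hmin]⟩, ?_⟩
  · rw [hmin]
    intro k hk
    have e0 := (stepEven p).isSignedDist hS
    have e1 := (stepOdd pn).isSignedDist hS
    have e2 := (stepEven n).isSignedDist hS
    have e3 := (stepOdd np).isSignedDist hS
    interval_cases k
    · simpa using e0
    · simpa [b0] using e1
    · simpa [b0, b1] using e2
    · simpa [b0, b1, b2, show ¬ Even 3 by decide] using e3
  · simp only [Finset.sum_range_succ, Finset.sum_range_zero]
    simp [show ¬ Even 3 by decide]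
    intro h
    -- The holonomy is twice the difference of these two numbers.
    have hlt : Real.arsinh (495 / 952) < Real.arsinh (33 / 56) :=
      Real.arsinh_lt_arsinh.2 (by norm_num)
    rw [distEven, distOdd] at h
    linarith
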